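/- Let $d$ be the spherical distance on the unit sphere $\mathbb S^2$, let $\mathbb D^2\subset\mathbb S^2$ be the open upper hemisphere, with boundary the equator $\partial\mathbb D^2=\mathbb S^1$, and let $\widehat{\mathrm{Ein}}_2=\mathbb S^1\times\mathbb R$ with the conformal structure of $ds^2-dt^2$, the future being the direction of increasing $t$. Timelike curves are (up to parametrization) the curves $t\mapsto(\varphi(t),t)$ with $\varphi$ contracting (i.e. $d(\varphi(s),\varphi(t))<|s-t|$ for $s\ne t$); the past lightcone of $(\varphi,t)$ is the union of its two past oriented lightlike geodesic rays $s\mapsto(\varphi\pm s,t-s)$, $s\ge 0$, and its future lightcone is the union of the rays $s\mapsto(\varphi\pm s,t+s)$, $s\ge 0$. Two points are opposite if they have the form $(\varphi,t)$, $(\varphi+\pi,t+\pi)$. A subset of $\widehat{\mathrm{Ein}}_2$ is achronal if no timelike curve joins two of its points; it is generic unless it is contained in the past lightcone and in the future lightcone, respectively, of two opposite elements of itself; it is nonelementary if no point of $\widehat{\mathrm{Ein}}_2$ contains it in its past lightcone and none contains it in its future lightcone. Let $E=\mathbb R^{2,2}$ be $\mathbb R^4$ with the quadratic form $Q=-u^2-v^2+x_1^2+x_2^2$,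 let $S(E)$ be its space of rays, and let $\mathbb{ADS}\subset S(E)$ be the radial projection of $\{Q=-1\}$. The map sending $(x,t)$ to the ray of $(\cos t,\sin t,x_0,x_1)$, where $x=(x_0,x_1,x_2)\in\overline{\mathbb D}^2$, projects $\mathbb D^2\times\mathbb R$ onto $\mathbb{ADS}$ and $\widehat{\mathrm{Ein}}_2$ onto $\mathrm{Ein}_2=\partial\mathbb{ADS}$. The convex hull of a subset of $S(E)$ is the radial projection of the convex hull in $E$ of the cone over it. For a closed achronal set $\Lambda\subset\widehat{\mathrm{Ein}}_2$, put, for $x\in\overline{\mathbb D}^2$, $$f_-(x)=\sup_{(y,t)\in\Lambda}\bigl(t-d(x,y)\bigr),\qquad f_+(x)=\inf_{(y,t)\in\Lambda}\bigl(t+d(x,y)\bigr).$$ The invisible domain $E(\Lambda)\subset\mathbb{ADS}$ is the projection of $\{(x,t)\in\mathbb D^2\times\mathbb R : f_-(x)<t<f_+(x)\}$, and $\Lambda^\pm$ is the graph of the restriction of $f_\pm$ to $\partial\mathbb D^2$. The future and past globally hyperbolic cores are $E(\Lambda^+)$ and $E(\Lambda^-)$. A gap pair $(x,y)$ of $\Lambda$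 consists of points $x,y\in\Lambda$ whose projections to $\partial\mathbb D^2$ are the extremities of a connected component $I$ of the complement in $\partial\mathbb D^2$ of the projection of $\Lambda$. Its diamond $\Delta_{xy}$ is the set of points $(\varphi,t)$ with $\varphi\in I$ that lie strictly between the graphs of the functions $f_-$ and $f_+$ associated with the two-point set $\{x,y\}$, and its closed end $\overline{\mathcal E}_{xy}$ is the intersection of $\mathbb{ADS}$ with the convex hull in $S(E)$ of the image of the closure of $\Delta_{xy}$. **Proposition.** Let $\Lambda\subset\widehat{\mathrm{Ein}}_2$ be a closed, generic, nonelementary achronal subset. Then $$E(\Lambda)=E(\Lambda^+)\cup E(\Lambda^-)\cup\bigcup_{(x,y)\text{ gap pair of }\Lambda}\overline{\mathcal E}_{xy}.$$ -/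

import Mathlib

namespace AdSInvisible

noncomputable section

/-! ### The Einstein universe and its causal structure -/

/-- The ambient space of the unit sphere `𝕊²`. -/
abbrev E3 : Type := EuclideanSpace ℝ (Fin 3)

/-- The spherical distance on the unit sphere of `E3`: the angle between two unit vectors. -/
def sphDist (x y : E3) : ℝ := InnerProductGeometry.angle x y

/-- The open upper hemisphere `𝔻²` of the unit sphere `𝕊²`. -/
def disc : Set E3 := {x | ‖x‖ = 1 ∧ 0 < x 2}

/-- The identification of the circle `𝕊¹` with the equator `∂𝔻²`. -/
def equator (φ : Real.Angle) : E3 := !₂[φ.cos, φ.sin, 0]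

/-- The cyclic covering `𝕊¹ × ℝ` of the Einstein universe `Ein₂`, where `𝕊¹ = ∂𝔻²`; its conformal
Lorentzian structure is that of `ds² - dt²`, and the future is the direction of increasing `t`. -/
abbrev EinHat : Type := Real.Angle × ℝ

/-- The curve `t ↦ (c t, t)`, for `t` in `[a, b]`, is timelike: `c` is contracting. -/
def IsTimelikeOn (c : ℝ → Real.Angle) (a b : ℝ) : Prop :=
  ∀ s ∈ Set.Icc a b, ∀ t ∈ Set.Icc a b, s ≠ t → sphDist (equator (c s)) (equator (c t)) < |s - t|

/-- There is a future oriented timelike curve from `p` to `q`. -/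
def ChronologicallyPrecedes (p q : EinHat) : Prop :=
  p.2 < q.2 ∧ ∃ c : ℝ → Real.Angle, IsTimelikeOn c p.2 q.2 ∧ c p.2 = p.1 ∧ c q.2 = q.1

/-- No timelike curve joins two points of `L`. -/
def IsAchronal (L : Set EinHat) : Prop :=
  ∀ p ∈ L, ∀ q ∈ L, ¬ ChronologicallyPrecedes p q

/-- The union of the two past oriented lightlike geodesic rays starting from `p`. -/
def pastLightcone (p : EinHat) : Set EinHat :=
  {q | ∃ s : ℝ, 0 ≤ s ∧ q.2 = p.2 - s ∧ (q.1 = p.1 + (s : Real.Angle) ∨ q.1 = p.1 - (s : Real.Angle))}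

/-- The union of the two future oriented lightlike geodesic rays starting from `p`. -/
def futureLightcone (p : EinHat) : Set EinHat :=
  {q | ∃ s : ℝ, 0 ≤ s ∧ q.2 = p.2 + s ∧ (q.1 = p.1 + (s : Real.Angle) ∨ q.1 = p.1 - (s : Real.Angle))}

/-- The generator of the group of covering transformations of `EinHat` over the projectivized
null cone: `(φ, t) ↦ (-φ, t + π)`, where `-φ` is the antipode of `φ`. -/
def opp (p : EinHat) : EinHat := (p.1 + (Real.pi : Real.Angle), p.2 + Real.pi)

/-- Two points are opposite if one of them is the image of the other under `opp`. -/
def AreOpposite (p q : EinHat) : Prop := p = opp q ∨ q = opp p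

/-- `L` is contained in the past lightcone and in the future lightcone of two opposite elements of
itself. -/
def IsPureLightlike (L : Set EinHat) : Prop :=
  ∃ p ∈ L, ∃ q ∈ L, AreOpposite p q ∧ L ⊆ pastLightcone p ∩ futureLightcone q

def IsGeneric (L : Set EinHat) : Prop := ¬ IsPureLightlike L

/-- The points whose past lightcone contains `L`. -/
def commonFuture (L : Set EinHat) : Set EinHat := {p | L ⊆ pastLightcone p}

/-- The points whose future lightcone contains `L`. -/
def commonPast (L : Set EinHat) : Set EinHat := {p | L ⊆ futureLightcone p}

def IsElementary (L : Set EinHat) : Prop := (commonFuture L).Nonempty ∨ (commonPast L).Nonempty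

/-! ### Invisible domains in the universal covering of anti-de Sitter space -/

/-- `f₋(x) = sup {t - d(x, y)}`, over the points `(y, t)` of `L`. -/
def fMinus (L : Set EinHat) (x : E3) : ℝ := ⨆ p : L, (p.1.2 - sphDist x (equator p.1.1))

/-- `f₊(x) = inf {t + d(x, y)}`, over the points `(y, t)` of `L`. -/
def fPlus (L : Set EinHat) (x : E3) : ℝ := ⨅ p : L, (p.1.2 + sphDist x (equator p.1.1))

/-- The invisible domain from `L` in the universal covering `𝔻² × ℝ` of anti-de Sitter space. -/
def invisibleHat (L : Set EinHat) : Set (E3 × ℝ) :=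
  {p | p.1 ∈ disc ∧ fMinus L p.1 < p.2 ∧ p.2 < fPlus L p.1}

/-- The invisible domain from `L` in the covering of the Einstein universe. -/
def omegaHat (L : Set EinHat) : Set EinHat :=
  {p | fMinus L (equator p.1) < p.2 ∧ p.2 < fPlus L (equator p.1)}

/-- `Λ⁺`, the graph of the restriction of `f₊` to `∂𝔻²`. -/
def upperCompletion (L : Set EinHat) : Set EinHat := {p | p.2 = fPlus L (equator p.1)}

/-- `Λ⁻`, the graph of the restriction of `f₋` to `∂𝔻²`. -/
def lowerCompletion (L : Set EinHat) : Set EinHat := {p | p.2 = fMinus L (equator p.1)}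

/-! ### The Klein model in the space of rays `S(E)` -/

/-- The vector space underlying `ℝ^{2,2}`, with coordinates `(u, v, x₁, x₂)`. -/
abbrev R22 : Type := Fin 4 → ℝ

/-- The quadratic form `-u² - v² + x₁² + x₂²`. -/
def Q (w : R22) : ℝ := -(w 0) ^ 2 - (w 1) ^ 2 + (w 2) ^ 2 + (w 3) ^ 2

/-- The space `S(E)` of rays of `E = ℝ^{2,2}`. -/
abbrev SE : Type := Module.Ray ℝ R22

/-- The radial projection to `S(E)` of (the nonzero elements of) a set of vectors. -/
def radialProj (S : Set R22) : Set SE :=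
  {r | ∃ (w : R22) (hw : w ≠ 0), w ∈ S ∧ rayOfNeZero ℝ w hw = r}

/-- The cone of all vectors that span a ray in `A`. -/
def coneOver (A : Set SE) : Set R22 :=
  {w | ∃ hw : w ≠ 0, rayOfNeZero ℝ w hw ∈ A}

/-- The convex hull in `S(E)`: the projection of the convex hull of the cone over the set. -/
def rayConvexHull (A : Set SE) : Set SE := radialProj (convexHull ℝ (coneOver A))

/-- The Klein model of anti-de Sitter space: the radial projection of `{Q = -1}`. -/
def klein : Set SE := radialProj {w | Q w = -1}

/-- A representative in `E` of the image in `S(E)` of a point `(x, t)` of the closed hemisphere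
times `ℝ`. For `x` in `∂𝔻²` it is a null vector, and this is the covering of `Ein₂`; for `x` in
`𝔻²` its quotient by the last coordinate of `x` satisfies `Q = -1`, and this is the conformal
covering of anti-de Sitter space. -/
def kleinVec (p : E3 × ℝ) : R22 := ![Real.cos p.2, Real.sin p.2, p.1 0, p.1 1]

/-- The image in the Klein model of a subset of `𝔻² × ℝ`. -/
def toKlein (S : Set (E3 × ℝ)) : Set SE := radialProj (kleinVec '' S)

/-- The image in `Ein₂ ⊆ S(E)` of a subset of `EinHat`. -/
def toEin (L : Set EinHat) : Set SE :=
  radialProj ((fun p : EinHat => kleinVec (equator p.1, p.2)) '' L)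

/-- `E(Λ)`: the invisible domain in the Klein model. -/
def invisible (L : Set EinHat) : Set SE := toKlein (invisibleHat L)

/-! ### Gap pairs and closed ends -/

/-- `x` and `y` are points of `L` whose projections to the circle are the extremities of the
connected component `I` of the complement of the projection of `L`. -/
def IsGapPair (L : Set EinHat) (x y : EinHat) (I : Set Real.Angle) : Prop :=
  x ∈ L ∧ y ∈ L ∧
    (∃ φ ∈ (Prod.fst '' L)ᶜ, I = connectedComponentIn (Prod.fst '' L)ᶜ φ) ∧
    frontier I = {x.1, y.1}

/-- The diamond `Δ_{xy}` over `I`: the part over `I` of the invisible domain from `{x, y}`. -/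
def diamond (x y : EinHat) (I : Set Real.Angle) : Set EinHat :=
  {p | p.1 ∈ I ∧ p ∈ omegaHat {x, y}}

/-- The closed end: the intersection of the Klein model with the convex hull in `S(E)` of the closed
diamond, which is the closed tetrahedron spanned by `x`, `y` and the two corners of the diamond. -/
def closedEnd (x y : EinHat) (I : Set Real.Angle) : Set SE :=
  klein ∩ rayConvexHull (toEin (closure (diamond x y I)))

end

end AdSInvisible

open AdSInvisible

/-!
Everything is expressed through the bilinear form of `ℝ^{2,2}`. A point `(x, t)` of `𝔻² × ℝ` and
a point `(y, s)` of the boundary satisfy `|t - s| < d(x, y)` exactly when the vectors representing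
them have negative product, up to a multiple of `2π` in `t`. Since spherical triangles have perimeter
at most `2π`, the multiple is the same for all points of an achronal set, so `E(Λ)` is the set of
rays of negative vectors having negative product with all points of `Λ`
(`rayOfNeZero_mem_invisible`, `formB_neg_of_mem_invisibleHat`).

In the null coordinates `u = (t + φ) / 2`, `v = (t - φ) / 2` the product of two boundary points is
`2 sin (u - u') sin (v - v')`. The closed diamond over a gap of `Λ` is a rectangle
`[u₀, u₁] × [v₀, v₁]` (`IsGapRect`, `closure_diamond_eq_image`), with the two points of the gap pair
at the corners `(u₀, v₁)` and `(u₁, v₀)`, and achronality places `Λ` in the complementary rectangle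
`[u₁, u₀ + π] × [v₁ - π, v₀]`. If a side of the first rectangle had length `π`, or if `Λ` contained
one of the other two corners of the complementary rectangle, then `Λ` would be contained in a
lightcone; so for `Λ` nonelementary the convex hull of the diamond is the tetrahedron spanned by its
corners.

A negative vector in this tetrahedron has positive coordinates at both points of the gap pair. Its
products with the points of `Λ` are sums of nonpositive terms, of which one is negative because no
point of `Λ` is lightlike related to both points of the pair. Hence closed ends are contained in
`E(Λ)` (`IsGapPair.closedEnd_subset_invisible`).

Conversely, `E(Λ)` and `E(Λ⁺)` have the same upper boundary `f₊`, so a point of `E(Λ)` outside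
`E(Λ⁺)` is hidden by a point `(y, f₊(y))`, and one outside `E(Λ⁻)` by a point `(z, f₋(z))`. If
both happen, `y` and `z` lie over the same gap: a point of `Λ` between them would turn the triangle
inequality into an equality, which makes `y` and `z` antipodal and `Λ` elementary
(`not_between_of_hidden`). Over a gap `Λ⁺` and `Λ⁻` run along the sides of the rectangle, so the
products with its upper and lower corners are nonnegative. These products are the coordinates in the
basis of the four corners, up to positive factors, and the point is in the closed end
(`IsGapRect.rayOfNeZero_mem_closedEnd`).
-/

namespace AdSInvisible

open Real Set

/-! ### Spherical distances to points of the equator -/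

@[simp] lemma norm_equator (φ : Real.Angle) : ‖equator φ‖ = 1 := by
  have h := φ.cos_sq_add_sin_sq
  simp [equator, EuclideanSpace.norm_eq, Fin.sum_univ_three, h]

lemma inner_equator (x : E3) (φ : Real.Angle) :
    inner ℝ x (equator φ) = x 0 * φ.cos + x 1 * φ.sin := by
  simp [equator, PiLp.inner_apply, Fin.sum_univ_three]
  ring

lemma sphDist_comm (x y : E3) : sphDist x y = sphDist y x :=
  InnerProductGeometry.angle_comm x y

lemma sphDist_nonneg (x y : E3) : 0 ≤ sphDist x y := InnerProductGeometry.angle_nonneg x y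

lemma sphDist_le_pi (x y : E3) : sphDist x y ≤ π := InnerProductGeometry.angle_le_pi x y

lemma sphDist_triangle (x y z : E3) : sphDist x z ≤ sphDist x y + sphDist y z :=
  InnerProductGeometry.angle_le_angle_add_angle x y z

/-- A spherical triangle has perimeter at most `2π`: this is the triangle inequality for the
antipode of one of the vertices. -/
lemma sphDist_perimeter (x y z : E3) : sphDist x y + sphDist x z + sphDist y z ≤ 2 * π := by
  have h := InnerProductGeometry.angle_le_angle_add_angle y (-x) z
  rw [InnerProductGeometry.angle_neg_right, InnerProductGeometry.angle_neg_left,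
    InnerProductGeometry.angle_comm y x] at h
  simp only [sphDist]
  linarith

lemma cos_sphDist_equator {x : E3} (hx : ‖x‖ = 1) (φ : Real.Angle) :
    cos (sphDist x (equator φ)) = x 0 * φ.cos + x 1 * φ.sin := by
  rw [sphDist, InnerProductGeometry.cos_angle, hx, norm_equator, inner_equator]
  simp

lemma continuous_sphDist_equator {x : E3} (hx : ‖x‖ = 1) :
    Continuous fun φ : Real.Angle => sphDist x (equator φ) := by
  have h : (fun φ : Real.Angle => sphDist x (equator φ)) =
      fun φ : Real.Angle => arccos (x 0 * φ.cos + x 1 * φ.sin) := by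
    funext φ
    rw [← cos_sphDist_equator hx, arccos_cos (sphDist_nonneg _ _) (sphDist_le_pi _ _)]
  rw [h]
  exact continuous_arccos.comp ((continuous_const.mul Real.Angle.continuous_cos).add
    (continuous_const.mul Real.Angle.continuous_sin))

lemma cos_sphDist_equator_equator (φ ψ : Real.Angle) :
    cos (sphDist (equator φ) (equator ψ)) = (φ - ψ).cos := by
  rw [cos_sphDist_equator (norm_equator φ)]
  induction φ using Real.Angle.induction_on with | _ s
  induction ψ using Real.Angle.induction_on with | _ t
  rw [← Real.Angle.coe_sub, Real.Angle.cos_coe (s - t), cos_sub]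
  simp [equator]

lemma sphDist_equator_equator (φ ψ : Real.Angle) :
    sphDist (equator φ) (equator ψ) = |(φ - ψ).toReal| := by
  apply injOn_cos ⟨sphDist_nonneg _ _, sphDist_le_pi _ _⟩
    ⟨abs_nonneg _, Real.Angle.abs_toReal_le_pi _⟩
  rw [cos_sphDist_equator_equator, cos_abs, Real.Angle.cos_toReal]

lemma sphDist_coe_eq {s t : ℝ} (h : |s - t| ≤ π) :
    sphDist (equator s) (equator t) = |s - t| := by
  apply injOn_cos ⟨sphDist_nonneg _ _, sphDist_le_pi _ _⟩ ⟨abs_nonneg _, h⟩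
  rw [cos_sphDist_equator_equator, cos_abs, ← Real.Angle.coe_sub, Real.Angle.cos_coe]

lemma sphDist_coe_le (s t : ℝ) : sphDist (equator s) (equator t) ≤ |s - t| := by
  rcases le_total |s - t| π with h | h
  · exact (sphDist_coe_eq h).le
  · exact (sphDist_le_pi _ _).trans h

lemma sphDist_add_coe_le (φ : Real.Angle) (s t : ℝ) :
    sphDist (equator (φ + (s : Real.Angle))) (equator (φ + (t : Real.Angle))) ≤ |s - t| := by
  rw [sphDist_equator_equator, add_sub_add_left_eq_sub, ← sphDist_equator_equator]
  exact sphDist_coe_le s t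

lemma coe_toIocMod (s t : ℝ) : ((toIocMod two_pi_pos s t : ℝ) : Real.Angle) = t := by
  rw [Real.Angle.angle_eq_iff_two_pi_dvd_sub]
  refine ⟨-toIocDiv two_pi_pos s t, ?_⟩
  have := toIocMod_add_toIocDiv_zsmul two_pi_pos s t
  rw [zsmul_eq_mul] at this
  push_cast
  linarith

lemma cos_le_cos_of_le_of_le_two_pi_sub {d r : ℝ} (h0 : 0 ≤ d) (h1 : d ≤ r)
    (h2 : r ≤ 2 * π - d) : cos r ≤ cos d := by
  rcases le_total r π with h | h
  · exact cos_le_cos_of_nonneg_of_le_pi h0 h h1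
  · rw [← cos_two_pi_sub r]
    exact cos_le_cos_of_nonneg_of_le_pi h0 (by linarith) (by linarith)

lemma coe_sub_two_pi (s : ℝ) : ((s - 2 * π : ℝ) : Real.Angle) = s := by
  simp

/-- The points over `s` and `t` are joined by two arcs, of lengths `t - s` and `2π - (t - s)`. -/
lemma sphDist_coe_eq_or {s t : ℝ} (h0 : 0 ≤ t - s) (h1 : t - s ≤ 2 * π) :
    sphDist (equator s) (equator t) = t - s ∨
      sphDist (equator s) (equator t) = 2 * π - (t - s) := by
  rcases le_total (t - s) π with h | h
  · left
    rw [sphDist_coe_eq (by rw [abs_le]; constructor <;> linarith), abs_sub_comm, abs_of_nonneg h0]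
  · right
    rw [← coe_sub_two_pi t, sphDist_coe_eq (by rw [abs_le]; constructor <;> linarith),
      abs_of_nonneg (by linarith)]
    ring

lemma sphDist_coe_le_two_pi_sub {s t : ℝ} (h : t - s ≤ 2 * π) :
    sphDist (equator s) (equator t) ≤ 2 * π - (t - s) := by
  rw [← coe_sub_two_pi t]
  refine (sphDist_coe_le _ _).trans ?_
  rw [abs_of_nonneg (by linarith)]
  linarith

lemma eq_add_or_eq_sub_sphDist (φ ψ : Real.Angle) :
    φ = ψ + ((sphDist (equator φ) (equator ψ) : ℝ) : Real.Angle) ∨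
      φ = ψ - ((sphDist (equator φ) (equator ψ) : ℝ) : Real.Angle) := by
  rw [sphDist_equator_equator]
  rcases abs_choice (φ - ψ).toReal with h | h <;> rw [h]
  · left; simp
  · right; simp

lemma disc_norm {x : E3} (hx : x ∈ disc) : (x 0) ^ 2 + (x 1) ^ 2 + (x 2) ^ 2 = 1 := by
  have h := hx.1
  rw [EuclideanSpace.norm_eq, sqrt_eq_one] at h
  simpa [Fin.sum_univ_three] using h

lemma sphDist_pos_of_mem_disc {x : E3} (hx : x ∈ disc) (φ : Real.Angle) :
    0 < sphDist x (equator φ) := by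
  refine (sphDist_nonneg _ _).lt_of_ne fun h => ?_
  have h1 := cos_sphDist_equator hx.1 φ
  rw [← h, cos_zero] at h1
  have h2 := disc_norm hx
  have h3 := φ.cos_sq_add_sin_sq
  have h4 : 0 < (x 2) ^ 2 := pow_pos hx.2 2
  nlinarith [sq_nonneg (x 0 - φ.cos), sq_nonneg (x 1 - φ.sin)]

/-- A point of the open hemisphere lies on a geodesic segment between two points of the equator
only if these are antipodal. The equality case of the triangle inequality makes the Gram
determinant of the three points vanish, and this determinant is `(x₂ sin (ψ - φ))²`. -/
lemma eq_add_pi_of_sphDist_add_eq {x : E3} (hx : x ∈ disc) {φ ψ : Real.Angle}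
    (h : sphDist x (equator φ) + sphDist x (equator ψ) = sphDist (equator φ) (equator ψ)) :
    ψ = φ + (π : Real.Angle) := by
  have hA := cos_sphDist_equator hx.1 φ
  have hB := cos_sphDist_equator hx.1 ψ
  have hC := cos_sphDist_equator_equator φ ψ
  have hpos := sphDist_pos_of_mem_disc hx φ
  have hpos' := sphDist_pos_of_mem_disc hx ψ
  rw [← h, cos_add] at hC
  have hn := disc_norm hx
  induction φ using Real.Angle.induction_on with | _ s
  induction ψ using Real.Angle.induction_on with | _ t
  simp only [Real.Angle.cos_coe, Real.Angle.sin_coe, ← Real.Angle.coe_sub] at hA hB hC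
  set a := sphDist x (equator s)
  set b := sphDist x (equator t)
  rw [cos_sub] at hC
  have key : (x 2 * (cos s * sin t - sin s * cos t)) ^ 2 = 0 := by
    have h1 := sin_sq_add_cos_sq s
    have h2 := sin_sq_add_cos_sq t
    have h3 := sin_sq_add_cos_sq a
    have h4 := sin_sq_add_cos_sq b
    have e1 : (sin a * sin b) ^ 2 = (1 - cos a ^ 2) * (1 - cos b ^ 2) := by
      rw [mul_pow, eq_sub_of_add_eq h3, eq_sub_of_add_eq h4]
    have e2 : sin a * sin b = cos a * cos b - (cos s * cos t + sin s * sin t) := by linarith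
    rw [e2, hA, hB] at e1
    have gram : (x 2 * (cos s * sin t - sin s * cos t)) ^ 2 =
        (x 0 ^ 2 + x 1 ^ 2 + x 2 ^ 2) * (sin s ^ 2 + cos s ^ 2) * (sin t ^ 2 + cos t ^ 2)
        + 2 * (x 0 * cos s + x 1 * sin s) * (x 0 * cos t + x 1 * sin t)
          * (cos s * cos t + sin s * sin t)
        - (x 0 * cos s + x 1 * sin s) ^ 2 * (sin t ^ 2 + cos t ^ 2)
        - (x 0 * cos t + x 1 * sin t) ^ 2 * (sin s ^ 2 + cos s ^ 2)
        - (cos s * cos t + sin s * sin t) ^ 2 * (x 0 ^ 2 + x 1 ^ 2 + x 2 ^ 2) := by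
      ring
    rw [hn, h1, h2] at gram
    linarith
  have hsin : sin (t - s) = 0 := by
    have h1 := pow_eq_zero_iff (two_ne_zero) |>.1 key
    rw [sin_sub]
    rcases mul_eq_zero.1 h1 with h2 | h2
    · exact absurd h2 hx.2.ne'
    · linarith
  have hts : ((t - s : ℝ) : Real.Angle) = 0 ∨ ((t - s : ℝ) : Real.Angle) = π := by
    rw [← Real.Angle.sin_eq_zero_iff, Real.Angle.sin_coe, hsin]
  rw [Real.Angle.coe_sub] at hts
  rcases hts with h0 | h0
  · rw [sub_eq_zero] at h0
    rw [h0, sphDist_equator_equator, sub_self, Real.Angle.toReal_zero, abs_zero] at h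
    linarith
  · rw [← h0]; abel

/-! ### Achronal sets and the functions `f₋`, `f₊` -/

/-- Two points of an achronal set satisfy the Lipschitz inequality, as otherwise the geodesic of
constant speed between their projections lifts to a timelike curve. -/
lemma IsAchronal.abs_sub_le {L : Set EinHat} (hL : IsAchronal L) {p q : EinHat} (hp : p ∈ L)
    (hq : q ∈ L) : |p.2 - q.2| ≤ sphDist (equator p.1) (equator q.1) := by
  wlog h : q.2 ≤ p.2 generalizing p q
  · rw [abs_sub_comm, sphDist_comm]
    exact this hq hp (le_of_not_ge h)
  rw [abs_of_nonneg (by linarith)]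
  by_contra! hlt
  have hT : 0 < p.2 - q.2 := (sphDist_nonneg _ _).trans_lt hlt
  set θ := (p.1 - q.1).toReal with hθ
  rw [sphDist_equator_equator, ← hθ] at hlt
  refine hL q hq p hp ⟨by linarith,
    fun τ => q.1 + (((τ - q.2) / (p.2 - q.2) * θ : ℝ) : Real.Angle), ?_, ?_, ?_⟩
  · intro s _ t _ hst
    have hst' : 0 < |s - t| := abs_pos.2 (sub_ne_zero.2 hst)
    calc sphDist (equator (q.1 + (((s - q.2) / (p.2 - q.2) * θ : ℝ) : Real.Angle)))
          (equator (q.1 + (((t - q.2) / (p.2 - q.2) * θ : ℝ) : Real.Angle)))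
        ≤ |(s - q.2) / (p.2 - q.2) * θ - (t - q.2) / (p.2 - q.2) * θ| := sphDist_add_coe_le _ _ _
      _ = |s - t| * (|θ| / (p.2 - q.2)) := by
          rw [← sub_mul, ← sub_div, sub_sub_sub_cancel_right, abs_mul, abs_div, abs_of_pos hT]
          ring
      _ < |s - t| * 1 := by
          apply mul_lt_mul_of_pos_left _ hst'
          rwa [div_lt_one hT]
      _ = |s - t| := mul_one _
  · simp
  · simp only [div_self hT.ne', one_mul, hθ, Real.Angle.coe_toReal]
    abel

lemma nonempty_of_not_isElementary {L : Set EinHat} (h : ¬ IsElementary L) : L.Nonempty := by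
  by_contra hne
  rw [not_nonempty_iff_eq_empty] at hne
  exact h (Or.inl ⟨0, by simp [commonFuture, hne]⟩)

lemma range_coe_Icc : (fun s : ℝ => (s : Real.Angle)) '' Icc (-π) π = univ := by
  refine eq_univ_of_forall fun φ => ⟨φ.toReal, ⟨?_, φ.toReal_le_pi⟩, φ.coe_toReal⟩
  exact φ.neg_pi_lt_toReal.le

lemma isCompact_univ_angle : IsCompact (univ : Set Real.Angle) := by
  rw [← range_coe_Icc]
  exact isCompact_Icc.image Real.Angle.continuous_coe

lemma IsAchronal.isCompact {L : Set EinHat} (hL : IsAchronal L) (hcl : IsClosed L) :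
    IsCompact L := by
  rcases L.eq_empty_or_nonempty with rfl | ⟨p, hp⟩
  · exact isCompact_empty
  refine (isCompact_univ_angle.prod (isCompact_Icc (a := p.2 - π) (b := p.2 + π))).of_isClosed_subset
    hcl fun q hq => ⟨mem_univ _, ?_⟩
  have h := (hL.abs_sub_le hq hp).trans (sphDist_le_pi _ _)
  rw [abs_le] at h
  constructor <;> linarith

section Compact

variable {K : Set EinHat} {x : E3}

lemma continuous_sub_sphDist (hx : ‖x‖ = 1) :
    Continuous fun p : EinHat => p.2 - sphDist x (equator p.1) :=
  continuous_snd.sub ((continuous_sphDist_equator hx).comp continuous_fst)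

lemma continuous_add_sphDist (hx : ‖x‖ = 1) :
    Continuous fun p : EinHat => p.2 + sphDist x (equator p.1) :=
  continuous_snd.add ((continuous_sphDist_equator hx).comp continuous_fst)

lemma le_fMinus (hK : IsCompact K) (hx : ‖x‖ = 1) {p : EinHat} (hp : p ∈ K) :
    p.2 - sphDist x (equator p.1) ≤ fMinus K x := by
  have h := hK.bddAbove_image (continuous_sub_sphDist hx).continuousOn
  rw [image_eq_range] at h
  exact le_ciSup h ⟨p, hp⟩

lemma fPlus_le (hK : IsCompact K) (hx : ‖x‖ = 1) {p : EinHat} (hp : p ∈ K) :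
    fPlus K x ≤ p.2 + sphDist x (equator p.1) := by
  have h := hK.bddBelow_image (continuous_add_sphDist hx).continuousOn
  rw [image_eq_range] at h
  exact ciInf_le h ⟨p, hp⟩

lemma fMinus_le (hne : K.Nonempty) {t : ℝ} (h : ∀ p ∈ K, p.2 - sphDist x (equator p.1) ≤ t) :
    fMinus K x ≤ t := by
  have := hne.to_subtype
  exact ciSup_le fun p => h p.1 p.2

lemma le_fPlus (hne : K.Nonempty) {t : ℝ} (h : ∀ p ∈ K, t ≤ p.2 + sphDist x (equator p.1)) :
    t ≤ fPlus K x := by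
  have := hne.to_subtype
  exact le_ciInf fun p => h p.1 p.2

lemma exists_fMinus_eq (hK : IsCompact K) (hne : K.Nonempty) (hx : ‖x‖ = 1) :
    ∃ p ∈ K, fMinus K x = p.2 - sphDist x (equator p.1) := by
  obtain ⟨p, hp, hmax⟩ := hK.exists_isMaxOn hne (continuous_sub_sphDist hx).continuousOn
  exact ⟨p, hp, le_antisymm (fMinus_le hne fun q hq => hmax hq) (le_fMinus hK hx hp)⟩

lemma exists_fPlus_eq (hK : IsCompact K) (hne : K.Nonempty) (hx : ‖x‖ = 1) :
    ∃ p ∈ K, fPlus K x = p.2 + sphDist x (equator p.1) := by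
  obtain ⟨p, hp, hmin⟩ := hK.exists_isMinOn hne (continuous_add_sphDist hx).continuousOn
  exact ⟨p, hp, le_antisymm (fPlus_le hK hx hp) (le_fPlus hne fun q hq => hmin hq)⟩

lemma fMinus_lt (hK : IsCompact K) (hne : K.Nonempty) (hx : ‖x‖ = 1) {t : ℝ}
    (h : ∀ p ∈ K, p.2 - sphDist x (equator p.1) < t) : fMinus K x < t := by
  obtain ⟨p, hp, e⟩ := exists_fMinus_eq hK hne hx
  exact e ▸ h p hp

lemma lt_fPlus (hK : IsCompact K) (hne : K.Nonempty) (hx : ‖x‖ = 1) {t : ℝ}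
    (h : ∀ p ∈ K, t < p.2 + sphDist x (equator p.1)) : t < fPlus K x := by
  obtain ⟨p, hp, e⟩ := exists_fPlus_eq hK hne hx
  exact e ▸ h p hp

lemma fPlus_le_add (hK : IsCompact K) (hne : K.Nonempty) {y : E3} (hx : ‖x‖ = 1)
    (hy : ‖y‖ = 1) : fPlus K x ≤ fPlus K y + sphDist x y := by
  obtain ⟨p, hp, e⟩ := exists_fPlus_eq hK hne hy
  have h1 := fPlus_le hK hx hp
  have h2 := sphDist_triangle x y (equator p.1)
  linarith

lemma sub_le_fMinus (hK : IsCompact K) (hne : K.Nonempty) {y : E3} (hx : ‖x‖ = 1)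
    (hy : ‖y‖ = 1) : fMinus K y - sphDist x y ≤ fMinus K x := by
  obtain ⟨p, hp, e⟩ := exists_fMinus_eq hK hne hy
  have h1 := le_fMinus hK hx hp
  have h2 := sphDist_triangle x y (equator p.1)
  linarith

end Compact

/-! ### The completions `Λ⁺` and `Λ⁻` -/

lemma continuous_of_abs_sub_le_sphDist {f : Real.Angle → ℝ}
    (h : ∀ φ ψ, f φ ≤ f ψ + sphDist (equator φ) (equator ψ)) : Continuous f := by
  rw [continuous_iff_continuousAt]
  intro φ
  rw [ContinuousAt, tendsto_iff_dist_tendsto_zero]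
  have hc := (continuous_sphDist_equator (norm_equator φ)).tendsto φ
  have h0 : sphDist (equator φ) (equator φ) = 0 := by
    simp [sphDist_equator_equator]
  rw [h0] at hc
  refine squeeze_zero (fun _ => dist_nonneg) (fun ψ => ?_) hc
  rw [Real.dist_eq, abs_le]
  have h1 := h φ ψ
  have h2 := h ψ φ
  rw [sphDist_comm (equator ψ)] at h2
  constructor <;> linarith

lemma isCompact_graph {f : Real.Angle → ℝ} (hf : Continuous f) :
    IsCompact {p : EinHat | p.2 = f p.1} := by
  have h : {p : EinHat | p.2 = f p.1} = (fun φ => (φ, f φ)) '' univ := by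
    ext ⟨φ, t⟩
    simp [eq_comm]
  rw [h]
  exact isCompact_univ_angle.image (by fun_prop)

section Completions

variable {L : Set EinHat}

lemma isCompact_upperCompletion (hK : IsCompact L) (hne : L.Nonempty) :
    IsCompact (upperCompletion L) :=
  isCompact_graph (continuous_of_abs_sub_le_sphDist fun _ _ =>
    fPlus_le_add hK hne (norm_equator _) (norm_equator _))

lemma isCompact_lowerCompletion (hK : IsCompact L) (hne : L.Nonempty) :
    IsCompact (lowerCompletion L) :=
  isCompact_graph (f := fun φ => fMinus L (equator φ))
    (continuous_of_abs_sub_le_sphDist fun φ ψ => by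
      have h := sub_le_fMinus hK hne (norm_equator ψ) (norm_equator φ)
      rw [sphDist_comm] at h
      linarith)

lemma IsAchronal.subset_upperCompletion (hL : IsAchronal L) (hK : IsCompact L) :
    L ⊆ upperCompletion L := by
  intro p hp
  apply le_antisymm
  · refine le_fPlus ⟨p, hp⟩ fun q hq => ?_
    have := le_of_abs_le (hL.abs_sub_le hp hq)
    linarith
  · have h := fPlus_le hK (norm_equator p.1) hp
    simpa [sphDist_equator_equator] using h

lemma IsAchronal.subset_lowerCompletion (hL : IsAchronal L) (hK : IsCompact L) :
    L ⊆ lowerCompletion L := by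
  intro p hp
  apply le_antisymm
  · have h := le_fMinus hK (norm_equator p.1) hp
    simpa [sphDist_equator_equator] using h
  · refine fMinus_le ⟨p, hp⟩ fun q hq => ?_
    have := neg_le_of_abs_le (hL.abs_sub_le hp hq)
    linarith

lemma invisibleHat_anti {M : Set EinHat} (h : L ⊆ M) (hne : L.Nonempty) (hM : IsCompact M) :
    invisibleHat M ⊆ invisibleHat L := by
  rintro ⟨x, t⟩ ⟨hx, h1, h2⟩
  exact ⟨hx, (fMinus_le hne fun p hp => le_fMinus hM hx.1 (h hp)).trans_lt h1,
    h2.trans_le (le_fPlus hne fun p hp => fPlus_le hM hx.1 (h hp))⟩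

/-- Passing to `Λ⁺` does not change `f₊`, so a point lost by `E(Λ⁺)` is not above `f₋` of `Λ⁺`. -/
lemma exists_add_le_fPlus (hK : IsCompact L) (hne : L.Nonempty) {p : E3 × ℝ}
    (hp : p ∈ invisibleHat L) (hp' : p ∉ invisibleHat (upperCompletion L)) :
    ∃ φ : Real.Angle, p.2 + sphDist p.1 (equator φ) ≤ fPlus L (equator φ) := by
  have hM := isCompact_upperCompletion hK hne
  have hneM : (upperCompletion L).Nonempty := ⟨(0, fPlus L (equator 0)), rfl⟩
  by_contra! hlt
  refine hp' ⟨hp.1, fMinus_lt hM hneM hp.1.1 fun q hq => ?_, lt_fPlus hM hneM hp.1.1 fun q hq => ?_⟩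
  · have := hlt q.1
    rw [← show q.2 = fPlus L (equator q.1) from hq] at this
    linarith
  · have h := fPlus_le_add hK hne hp.1.1 (norm_equator q.1)
    rw [← show q.2 = fPlus L (equator q.1) from hq] at h
    exact hp.2.2.trans_le h

/-- Passing to `Λ⁻` does not change `f₋`, so a point lost by `E(Λ⁻)` is not below `f₊` of `Λ⁻`. -/
lemma exists_fMinus_add_le (hK : IsCompact L) (hne : L.Nonempty) {p : E3 × ℝ}
    (hp : p ∈ invisibleHat L) (hp' : p ∉ invisibleHat (lowerCompletion L)) :
    ∃ φ : Real.Angle, fMinus L (equator φ) + sphDist p.1 (equator φ) ≤ p.2 := by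
  have hM := isCompact_lowerCompletion hK hne
  have hneM : (lowerCompletion L).Nonempty := ⟨(0, fMinus L (equator 0)), rfl⟩
  by_contra! hlt
  refine hp' ⟨hp.1, fMinus_lt hM hneM hp.1.1 fun q hq => ?_, lt_fPlus hM hneM hp.1.1 fun q hq => ?_⟩
  · have h := sub_le_fMinus hK hne hp.1.1 (norm_equator q.1)
    rw [← show q.2 = fMinus L (equator q.1) from hq] at h
    exact h.trans_lt hp.2.1
  · have := hlt q.1
    rwa [← show q.2 = fMinus L (equator q.1) from hq] at this

/-- The point where `Λ⁺` hides a point of `E(Λ)` and the point where `Λ⁻` does are not separated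
by `Λ`: if a point of `Λ` lay between them, the triangle inequality would be an equality, so they
would be antipodal and `Λ` would be contained in a past lightcone. -/
lemma not_between_of_hidden (hK : IsCompact L) (hnonel : ¬ IsElementary L) {x : E3}
    (hx : x ∈ disc) {t : ℝ} {φ ψ : Real.Angle}
    (h1 : t + sphDist x (equator φ) ≤ fPlus L (equator φ))
    (h2 : fMinus L (equator ψ) + sphDist x (equator ψ) ≤ t) {q : EinHat} (hq : q ∈ L) :
    sphDist (equator φ) (equator ψ) <
      sphDist (equator φ) (equator q.1) + sphDist (equator ψ) (equator q.1) := by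
  by_contra! hle
  have hf := fPlus_le hK (norm_equator φ) hq
  have hg := le_fMinus hK (norm_equator ψ) hq
  have htri := sphDist_triangle (equator φ) x (equator ψ)
  rw [sphDist_comm (equator φ) x] at htri
  have hanti : ψ = φ + (π : Real.Angle) := eq_add_pi_of_sphDist_add_eq hx (by linarith)
  have hd : sphDist (equator φ) (equator ψ) = π := by
    rw [hanti, sphDist_equator_equator]
    simp [abs_of_pos pi_pos]
  refine hnonel (Or.inl ⟨(φ, fPlus L (equator φ)), fun r hr => ?_⟩)
  have hf' := fPlus_le hK (norm_equator φ) hr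
  have hg' := le_fMinus hK (norm_equator ψ) hr
  have hper : sphDist (equator φ) (equator r.1) + sphDist (equator ψ) (equator r.1) = π := by
    have e := cos_sphDist_equator_equator ψ r.1
    rw [hanti, show φ + (π : Real.Angle) - r.1 = φ - r.1 + (π : Real.Angle) by abel,
      Real.Angle.cos_add_pi, ← cos_sphDist_equator_equator, ← cos_pi_sub] at e
    have := injOn_cos ⟨sphDist_nonneg _ _, sphDist_le_pi _ _⟩
      ⟨by linarith [sphDist_le_pi (equator φ) (equator r.1)],
        by linarith [sphDist_nonneg (equator φ) (equator r.1)]⟩ e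
    rw [hanti]
    linarith
  refine ⟨sphDist (equator r.1) (equator φ), sphDist_nonneg _ _, ?_,
    eq_add_or_eq_sub_sphDist r.1 φ⟩
  rw [sphDist_comm (equator r.1)]
  simp only
  linarith

end Completions

/-! ### The invisible domain in the Klein model -/

/-- The symmetric bilinear form of `ℝ^{2,2}`, with `formB w w = Q w`. -/
def formB (v w : R22) : ℝ := -(v 0 * w 0) - v 1 * w 1 + v 2 * w 2 + v 3 * w 3

/-- The vector of `ℝ^{2,2}` representing the image in `Ein₂` of a point of its covering. -/
noncomputable def nullVec (p : EinHat) : R22 := kleinVec (equator p.1, p.2)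

lemma formB_add_left (v v' w : R22) : formB (v + v') w = formB v w + formB v' w := by
  simp only [formB, Pi.add_apply]; ring

lemma formB_smul_left (c : ℝ) (v w : R22) : formB (c • v) w = c * formB v w := by
  simp only [formB, Pi.smul_apply, smul_eq_mul]; ring

lemma formB_add_right (v w w' : R22) : formB v (w + w') = formB v w + formB v w' := by
  simp only [formB, Pi.add_apply]; ring

lemma formB_smul_right (c : ℝ) (v w : R22) : formB v (c • w) = c * formB v w := by
  simp only [formB, Pi.smul_apply, smul_eq_mul]; ring

lemma Q_smul (c : ℝ) (w : R22) : Q (c • w) = c ^ 2 * Q w := by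
  simp only [Q, Pi.smul_apply, smul_eq_mul]; ring

lemma kleinVec_ne_zero (p : E3 × ℝ) : kleinVec p ≠ 0 := by
  intro h
  have h0 := congrFun h 0
  have h1 := congrFun h 1
  simp only [kleinVec, Matrix.cons_val_zero, Matrix.cons_val_one, Pi.zero_apply] at h0 h1
  have := sin_sq_add_cos_sq p.2
  rw [h0, h1] at this
  norm_num at this

lemma nullVec_ne_zero (p : EinHat) : nullVec p ≠ 0 := kleinVec_ne_zero _

/-- The sign of the form decides the causal relation between a point of `ADS` and a point of its
boundary. -/
lemma formB_kleinVec_nullVec {x : E3} (hx : ‖x‖ = 1) (t : ℝ) (p : EinHat) :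
    formB (kleinVec (x, t)) (nullVec p) = cos (sphDist x (equator p.1)) - cos (t - p.2) := by
  rw [cos_sphDist_equator hx, cos_sub]
  simp [formB, nullVec, kleinVec, equator]
  ring

/-- The sign conditions only give the inequalities defining the invisible domain modulo `2π`; that
these hold at the same multiple of `2π` for all points of `L` follows from achronality and the
bound `2π` on the perimeter of spherical triangles. -/
lemma mem_invisibleHat_of_formB_neg {L : Set EinHat} (hL : IsAchronal L) (hK : IsCompact L)
    {x : E3} (hx : x ∈ disc) {t : ℝ} {q : EinHat} (hq : q ∈ L) (hqt : |t - q.2| ≤ π)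
    (h : ∀ p ∈ L, formB (kleinVec (x, t)) (nullVec p) < 0) : (x, t) ∈ invisibleHat L := by
  have key : ∀ p ∈ L, ∀ s : ℝ, |s| ≤ π → cos s = cos (t - p.2) →
      |s| < sphDist x (equator p.1) := by
    intro p hp s hs he
    have h1 := h p hp
    rw [formB_kleinVec_nullVec hx.1, ← he, ← cos_abs s] at h1
    by_contra! hle
    have := strictAntiOn_cos.antitoneOn ⟨sphDist_nonneg _ _, sphDist_le_pi _ _⟩
      ⟨abs_nonneg _, hs⟩ hle
    linarith
  have hq' := key q hq _ hqt rfl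
  have main : ∀ p ∈ L, |t - p.2| < sphDist x (equator p.1) := by
    intro p hp
    set r : Real.Angle := ((t - p.2 : ℝ) : Real.Angle) with hr
    have h1 := key p hp r.toReal r.abs_toReal_le_pi (by rw [Real.Angle.cos_toReal]; rfl)
    have h2 := r.coe_toReal
    rw [hr, Real.Angle.angle_eq_iff_two_pi_dvd_sub] at h2
    obtain ⟨k, hk⟩ := h2
    rw [← hr] at hk
    have h3 := hL.abs_sub_le hp hq
    have h4 := sphDist_perimeter x (equator p.1) (equator q.1)
    rw [abs_lt] at h1 hq'
    rw [abs_le] at h3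
    have hk1 : (-1 : ℝ) < k := by
      by_contra! hc
      have := mul_le_mul_of_nonneg_left hc two_pi_pos.le
      linarith
    have hk2 : (k : ℝ) < 1 := by
      by_contra! hc
      have := mul_le_mul_of_nonneg_left hc two_pi_pos.le
      linarith
    have hk0 : k = 0 := by
      have a1 : -1 < k := by exact_mod_cast hk1
      have a2 : k < 1 := by exact_mod_cast hk2
      omega
    rw [hk0] at hk
    rw [abs_lt]
    simp only [Int.cast_zero, mul_zero] at hk
    constructor <;> linarith
  refine ⟨hx, fMinus_lt hK ⟨q, hq⟩ hx.1 fun p hp => ?_, lt_fPlus hK ⟨q, hq⟩ hx.1 fun p hp => ?_⟩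
  · have := (abs_lt.1 (main p hp)).1
    simp only
    linarith
  · have := (abs_lt.1 (main p hp)).2
    simp only
    linarith

lemma formB_neg_of_mem_invisibleHat {L : Set EinHat} (hK : IsCompact L)
    {p : E3 × ℝ} (hp : p ∈ invisibleHat L) {q : EinHat} (hq : q ∈ L) :
    formB (kleinVec p) (nullVec q) < 0 := by
  obtain ⟨hx, h1, h2⟩ := hp
  have h3 := le_fMinus hK hx.1 hq
  have h4 := fPlus_le hK hx.1 hq
  rw [show p = (p.1, p.2) from rfl, formB_kleinVec_nullVec hx.1, sub_neg, ← cos_abs (p.2 - q.2)]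
  refine strictAntiOn_cos ⟨abs_nonneg _, ?_⟩ ⟨sphDist_nonneg _ _, sphDist_le_pi _ _⟩ ?_
  · exact abs_le.2 ⟨by linarith [sphDist_le_pi p.1 (equator q.1)],
      by linarith [sphDist_le_pi p.1 (equator q.1)]⟩
  · exact abs_lt.2 ⟨by linarith, by linarith⟩

lemma exists_smul_kleinVec {w : R22} (hw : Q w < 0) (t₀ : ℝ) :
    ∃ x ∈ disc, ∃ t : ℝ, |t - t₀| ≤ π ∧ ∃ c : ℝ, 0 < c ∧ w = c • kleinVec (x, t) := by
  simp only [Q] at hw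
  have hpos : 0 < w 0 ^ 2 + w 1 ^ 2 := by nlinarith [sq_nonneg (w 2), sq_nonneg (w 3)]
  set c := √(w 0 ^ 2 + w 1 ^ 2) with hc
  have hc0 : 0 < c := sqrt_pos.2 hpos
  have hc2 : c ^ 2 = w 0 ^ 2 + w 1 ^ 2 := sq_sqrt hpos.le
  let z : ℂ := ⟨w 0, w 1⟩
  have hz : ‖z‖ = c := by
    rw [hc, Complex.norm_def, Complex.normSq_apply]
    congr 1
    simp only [z]
    ring
  set s : Real.Angle := ((z.arg - t₀ : ℝ) : Real.Angle) with hs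
  have hcos : cos (t₀ + s.toReal) = cos z.arg := by
    rw [← Real.Angle.cos_coe, Real.Angle.coe_add, Real.Angle.coe_toReal, hs, ← Real.Angle.coe_add,
      add_sub_cancel, Real.Angle.cos_coe]
  have hsin : sin (t₀ + s.toReal) = sin z.arg := by
    rw [← Real.Angle.sin_coe, Real.Angle.coe_add, Real.Angle.coe_toReal, hs, ← Real.Angle.coe_add,
      add_sub_cancel, Real.Angle.sin_coe]
  have e0 : c * cos z.arg = w 0 := by rw [← hz, Complex.norm_mul_cos_arg]
  have e1 : c * sin z.arg = w 1 := by rw [← hz, Complex.norm_mul_sin_arg]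
  have hlt : (w 2 / c) ^ 2 + (w 3 / c) ^ 2 < 1 := by
    rw [div_pow, div_pow, ← add_div, div_lt_one (by positivity), hc2]
    linarith
  have hr : 0 < 1 - ((w 2 / c) ^ 2 + (w 3 / c) ^ 2) := by linarith
  refine ⟨!₂[w 2 / c, w 3 / c, √(1 - ((w 2 / c) ^ 2 + (w 3 / c) ^ 2))], ⟨?_, ?_⟩,
    t₀ + s.toReal, ?_, c, hc0, ?_⟩
  · rw [EuclideanSpace.norm_eq, sqrt_eq_one]
    simp only [Fin.sum_univ_three, Real.norm_eq_abs, sq_abs]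
    simp [sq_sqrt hr.le]
  · simpa using hr
  · rw [add_sub_cancel_left]
    exact s.abs_toReal_le_pi
  · funext i
    fin_cases i
    · simp [kleinVec, hcos, e0]
    · simp [kleinVec, hsin, e1]
    · simp [kleinVec, mul_div_cancel₀ _ hc0.ne']
    · simp [kleinVec, mul_div_cancel₀ _ hc0.ne']

lemma rayOfNeZero_smul_eq {w v : R22} {c : ℝ} (hc : 0 < c) (h : w = c • v) (hw : w ≠ 0)
    (hv : v ≠ 0) : rayOfNeZero ℝ w hw = rayOfNeZero ℝ v hv := by
  rw [ray_eq_iff, h]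
  exact SameRay.sameRay_pos_smul_left v hc

/-- The invisible domain contains every ray of negative vectors whose products with the vectors
representing the points of `L` are negative. -/
lemma rayOfNeZero_mem_invisible {L : Set EinHat} (hL : IsAchronal L) (hK : IsCompact L)
    (hne : L.Nonempty) {w : R22} (hw : w ≠ 0) (hQ : Q w < 0)
    (h : ∀ p ∈ L, formB w (nullVec p) < 0) : rayOfNeZero ℝ w hw ∈ invisible L := by
  obtain ⟨q, hq⟩ := hne
  obtain ⟨x, hx, t, ht, c, hc, e⟩ := exists_smul_kleinVec hQ q.2
  refine ⟨kleinVec (x, t), kleinVec_ne_zero _, ⟨(x, t), ?_, rfl⟩,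
    (rayOfNeZero_smul_eq hc e hw _).symm⟩
  refine mem_invisibleHat_of_formB_neg hL hK hx hq ht fun p hp => ?_
  have := h p hp
  rw [e, formB_smul_left] at this
  exact neg_of_mul_neg_right this hc.le

lemma Q_kleinVec_neg {p : E3 × ℝ} (hp : p.1 ∈ disc) : Q (kleinVec p) < 0 := by
  have h := disc_norm hp
  have h2 : 0 < (p.1 2) ^ 2 := pow_pos hp.2 2
  have h3 := sin_sq_add_cos_sq p.2
  simp only [Q, kleinVec, Matrix.cons_val]
  linarith

lemma rayOfNeZero_mem_klein_iff {w : R22} (hw : w ≠ 0) :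
    rayOfNeZero ℝ w hw ∈ klein ↔ Q w < 0 := by
  constructor
  · rintro ⟨v, hv, hQ, hr⟩
    rw [ray_eq_iff] at hr
    obtain ⟨c, hc, e⟩ := hr.exists_pos_left hv hw
    rw [← e, Q_smul, show Q v = -1 from hQ]
    nlinarith [pow_pos hc 2]
  · intro h
    have hs : 0 < √(-Q w) := sqrt_pos.2 (by linarith)
    have hne : (√(-Q w))⁻¹ • w ≠ 0 := smul_ne_zero (inv_ne_zero hs.ne') hw
    refine ⟨_, hne, ?_, rayOfNeZero_smul_eq (inv_pos.2 hs) rfl hne hw⟩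
    rw [mem_ofPred_eq, Q_smul, inv_pow, sq_sqrt (by linarith)]
    rw [inv_neg, neg_mul, inv_mul_cancel₀ h.ne]

/-! ### Null coordinates -/

/-- The point of `EinHat` with null coordinates `u`, `v`: the lines where `u` or `v` is constant are
the lightlike geodesics. -/
noncomputable def nullPt (u v : ℝ) : EinHat := (((u - v : ℝ) : Real.Angle), u + v)

lemma continuous_nullPt : Continuous fun p : ℝ × ℝ => nullPt p.1 p.2 :=
  (Real.Angle.continuous_coe.comp (continuous_fst.sub continuous_snd)).prodMk
    (continuous_fst.add continuous_snd)

lemma nullPt_half (s t : ℝ) : nullPt ((t + s) / 2) ((t - s) / 2) = ((s : Real.Angle), t) := by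
  unfold nullPt
  congr 2 <;> ring

lemma nullVec_nullPt (u v : ℝ) :
    nullVec (nullPt u v) = ![cos (u + v), sin (u + v), cos (u - v), sin (u - v)] := by
  funext i
  fin_cases i <;> simp [nullVec, kleinVec, nullPt, equator, -Real.Angle.coe_sub]

lemma formB_nullPt (u v u' v' : ℝ) :
    formB (nullVec (nullPt u v)) (nullVec (nullPt u' v')) = 2 * sin (u - u') * sin (v - v') := by
  rw [nullVec_nullPt, nullVec_nullPt]
  simp only [formB, Matrix.cons_val, cos_add, sin_add, cos_sub, sin_sub]
  ring

lemma sin_smul_nullVec_left (u₀ u u₁ v : ℝ) :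
    sin (u₁ - u₀) • nullVec (nullPt u v) =
      sin (u₁ - u) • nullVec (nullPt u₀ v) + sin (u - u₀) • nullVec (nullPt u₁ v) := by
  simp only [nullVec_nullPt]
  funext i
  fin_cases i <;>
  · simp [cos_add, sin_add, cos_sub, sin_sub]
    ring

lemma sin_smul_nullVec_right (u v₀ v v₁ : ℝ) :
    sin (v₁ - v₀) • nullVec (nullPt u v) =
      sin (v₁ - v) • nullVec (nullPt u v₀) + sin (v - v₀) • nullVec (nullPt u v₁) := by
  simp only [nullVec_nullPt]
  funext i
  fin_cases i <;>
  · simp [cos_add, sin_add, cos_sub, sin_sub]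
    ring

/-- A point of a lightlike segment shorter than `π` in null coordinates is a nontrivial nonnegative
combination of the endpoints; this includes the case of a segment reduced to a point. -/
lemma exists_nonneg_combination {f : ℝ → R22} {r₀ r₁ : ℝ}
    (hf : ∀ r, sin (r₁ - r₀) • f r = sin (r₁ - r) • f r₀ + sin (r - r₀) • f r₁)
    (h : r₁ - r₀ < π) {r : ℝ} (hr : r ∈ Icc r₀ r₁) :
    ∃ c d : ℝ, 0 ≤ c ∧ 0 ≤ d ∧ 0 < c + d ∧ f r = c • f r₀ + d • f r₁ := by
  rcases (hr.1.trans hr.2).eq_or_lt with e | hlt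
  · have : r = r₀ := le_antisymm (e ▸ hr.2) hr.1
    exact ⟨1, 0, by norm_num, le_rfl, by norm_num, by simp [this]⟩
  · have hs : 0 < sin (r₁ - r₀) := sin_pos_of_pos_of_lt_pi (by linarith) h
    have h1 : 0 ≤ sin (r₁ - r) :=
      sin_nonneg_of_nonneg_of_le_pi (by linarith [hr.2]) (by linarith [hr.1])
    have h2 : 0 ≤ sin (r - r₀) :=
      sin_nonneg_of_nonneg_of_le_pi (by linarith [hr.1]) (by linarith [hr.2])
    refine ⟨sin (r₁ - r) / sin (r₁ - r₀), sin (r - r₀) / sin (r₁ - r₀), by positivity,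
      by positivity, ?_, ?_⟩
    · rw [← add_div]
      refine div_pos ?_ hs
      rcases hr.2.eq_or_lt with e | hlt'
      · rw [e]; simpa using hs
      · exact add_pos_of_pos_of_nonneg
          (sin_pos_of_pos_of_lt_pi (by linarith) (by linarith [hr.1])) h2
    · rw [div_eq_inv_mul, div_eq_inv_mul, mul_smul, mul_smul, ← smul_add, ← hf,
        inv_smul_smul₀ hs.ne']

lemma exists_combination_left (v : ℝ) {u₀ u₁ : ℝ} (h : u₁ - u₀ < π) {u : ℝ} (hu : u ∈ Icc u₀ u₁) :
    ∃ c d : ℝ, 0 ≤ c ∧ 0 ≤ d ∧ 0 < c + d ∧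
      nullVec (nullPt u v) = c • nullVec (nullPt u₀ v) + d • nullVec (nullPt u₁ v) :=
  exists_nonneg_combination (f := fun u => nullVec (nullPt u v))
    (fun _ => sin_smul_nullVec_left _ _ _ _) h hu

lemma exists_combination_right (u : ℝ) {v₀ v₁ : ℝ} (h : v₁ - v₀ < π) {v : ℝ}
    (hv : v ∈ Icc v₀ v₁) :
    ∃ c d : ℝ, 0 ≤ c ∧ 0 ≤ d ∧ 0 < c + d ∧
      nullVec (nullPt u v) = c • nullVec (nullPt u v₀) + d • nullVec (nullPt u v₁) :=
  exists_nonneg_combination (f := fun v => nullVec (nullPt u v))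
    (fun _ => sin_smul_nullVec_right _ _ _ _) h hv

/-- The decomposition of a vector in the basis given by the four corners of a rectangle in null
coordinates. -/
lemma smul_eq_corner_combination (u₀ u₁ v₀ v₁ : ℝ) (w : R22) :
    (2 * sin (u₁ - u₀) * sin (v₁ - v₀)) • w =
      (-formB w (nullVec (nullPt u₁ v₀))) • nullVec (nullPt u₀ v₁)
      + (-formB w (nullVec (nullPt u₀ v₁))) • nullVec (nullPt u₁ v₀)
      + formB w (nullVec (nullPt u₀ v₀)) • nullVec (nullPt u₁ v₁)
      + formB w (nullVec (nullPt u₁ v₁)) • nullVec (nullPt u₀ v₀) := by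
  simp only [nullVec_nullPt]
  funext i
  fin_cases i <;>
  · simp [formB, cos_add, sin_add, cos_sub, sin_sub]
    ring

lemma mem_pastLightcone_left {u u' v : ℝ} (h : u' ≤ u) :
    nullPt u' v ∈ pastLightcone (nullPt u v) := by
  refine ⟨u - u', by linarith, ?_, Or.inr ?_⟩
  · simp only [nullPt]; ring
  · simp only [nullPt, Real.Angle.coe_sub]; abel

lemma mem_pastLightcone_right {u v v' : ℝ} (h : v' ≤ v) :
    nullPt u v' ∈ pastLightcone (nullPt u v) := by
  refine ⟨v - v', by linarith, ?_, Or.inl ?_⟩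
  · simp only [nullPt]; ring
  · simp only [nullPt, Real.Angle.coe_sub]; abel

lemma mem_futureLightcone_left {u u' v : ℝ} (h : u ≤ u') :
    nullPt u' v ∈ futureLightcone (nullPt u v) := by
  refine ⟨u' - u, by linarith, ?_, Or.inl ?_⟩
  · simp only [nullPt]; ring
  · simp only [nullPt, Real.Angle.coe_sub]; abel

lemma mem_futureLightcone_right {u v v' : ℝ} (h : v ≤ v') :
    nullPt u v' ∈ futureLightcone (nullPt u v) := by
  refine ⟨v' - v, by linarith, ?_, Or.inr ?_⟩
  · simp only [nullPt]; ring
  · simp only [nullPt, Real.Angle.coe_sub]; abel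

lemma IsAchronal.mul_nonpos {L : Set EinHat} (hL : IsAchronal L) {u v u' v' : ℝ}
    (h : nullPt u v ∈ L) (h' : nullPt u' v' ∈ L) : (u - u') * (v - v') ≤ 0 := by
  have h1 := (hL.abs_sub_le h h').trans (sphDist_coe_le _ _)
  have h2 := sq_le_sq.2 h1
  simp only [nullPt] at h2
  nlinarith

/-! ### The null rectangle over a gap -/

/-- The arc from `u₀ - v₁` to `u₁ - v₀` contains no projection of a point of `L`, and its ends are
the projections of the points of `L` with null coordinates `(u₀, v₁)` and `(u₁, v₀)`. The closed
diamond over the arc is then the rectangle `[u₀, u₁] × [v₀, v₁]` in null coordinates. -/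
structure IsGapRect (L : Set EinHat) (u₀ u₁ v₀ v₁ : ℝ) : Prop where
  lt : u₀ - v₁ < u₁ - v₀
  left_mem : nullPt u₀ v₁ ∈ L
  right_mem : nullPt u₁ v₀ ∈ L
  not_mem : ∀ s ∈ Ioo (u₀ - v₁) (u₁ - v₀), (s : Real.Angle) ∉ Prod.fst '' L

namespace IsGapRect

variable {L : Set EinHat} {u₀ u₁ v₀ v₁ : ℝ}

lemma abs_le_of_isAchronal (h : IsGapRect L u₀ u₁ v₀ v₁) (hL : IsAchronal L) :
    u₀ ≤ u₁ ∧ v₀ ≤ v₁ := by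
  have h1 := (hL.abs_sub_le h.right_mem h.left_mem).trans (sphDist_coe_le _ _)
  rw [abs_of_pos (a := u₁ - v₀ - (u₀ - v₁)) (by linarith [h.lt]), abs_le] at h1
  simp only [nullPt] at h1
  constructor <;> linarith [h1.1, h1.2]

/-- The achronal set lies in the rectangle complementary to the diamond. -/
lemma exists_nullPt_eq (h : IsGapRect L u₀ u₁ v₀ v₁) (hL : IsAchronal L) {q : EinHat}
    (hq : q ∈ L) : ∃ u ∈ Icc u₁ (u₀ + π), ∃ v ∈ Icc (v₁ - π) v₀, q = nullPt u v := by
  obtain ⟨φ, t⟩ := q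
  obtain ⟨s, hs, rfl⟩ : ∃ s ∈ Ioc (u₀ - v₁) (u₀ - v₁ + 2 * π), (s : Real.Angle) = φ := by
    induction φ using Real.Angle.induction_on with | _ r
    exact ⟨toIocMod two_pi_pos (u₀ - v₁) r, toIocMod_mem_Ioc _ _ _, coe_toIocMod _ _⟩
  have hs' : u₁ - v₀ ≤ s := by
    by_contra! hc
    exact h.not_mem s ⟨hs.1, hc⟩ ⟨_, hq, rfl⟩
  have h1 := (hL.abs_sub_le hq h.right_mem).trans (sphDist_coe_le _ _)
  rw [abs_of_nonneg (a := s - (u₁ - v₀)) (by linarith), abs_le] at h1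
  have h2 := hL.abs_sub_le h.left_mem hq
  have h3 := h2.trans (sphDist_coe_le_two_pi_sub (by linarith [hs.2]))
  rw [abs_le] at h3
  simp only [nullPt] at h1 h3
  refine ⟨(t + s) / 2, ⟨?_, ?_⟩, (t - s) / 2, ⟨?_, ?_⟩, (nullPt_half s t).symm⟩ <;>
  linarith [h1.1, h1.2, h3.1, h3.2]

/-- If a side of the rectangle had length `π`, the complementary rectangle would be a lightlike
segment containing `L`. -/
lemma sub_lt_pi (h : IsGapRect L u₀ u₁ v₀ v₁) (hL : IsAchronal L) (hnonel : ¬ IsElementary L) :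
    u₁ - u₀ < π ∧ v₁ - v₀ < π := by
  constructor
  · by_contra! hc
    refine hnonel (Or.inl ⟨nullPt u₁ v₀, fun q hq => ?_⟩)
    obtain ⟨u, hu, v, hv, rfl⟩ := h.exists_nullPt_eq hL hq
    rw [show u = u₁ by linarith [hu.1, hu.2]]
    exact mem_pastLightcone_right hv.2
  · by_contra! hc
    refine hnonel (Or.inr ⟨nullPt u₁ v₀, fun q hq => ?_⟩)
    obtain ⟨u, hu, v, hv, rfl⟩ := h.exists_nullPt_eq hL hq
    rw [show v = v₀ by linarith [hv.1, hv.2]]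
    exact mem_futureLightcone_left hu.1

/-- The corner `(u₀ + π, v₀)` of the complementary rectangle is not in `L`: its past lightcone
would contain `L`. -/
lemma upper_corner_not_mem (h : IsGapRect L u₀ u₁ v₀ v₁) (hL : IsAchronal L)
    (hnonel : ¬ IsElementary L) : nullPt (u₀ + π) v₀ ∉ L := by
  intro hc
  refine hnonel (Or.inl ⟨nullPt (u₀ + π) v₀, fun q hq => ?_⟩)
  obtain ⟨u, hu, v, hv, rfl⟩ := h.exists_nullPt_eq hL hq
  have := hL.mul_nonpos hc hq
  rcases hu.2.eq_or_lt with e | hlt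
  · rw [e]; exact mem_pastLightcone_right hv.2
  · rw [show v = v₀ from le_antisymm hv.2 (by nlinarith)]
    exact mem_pastLightcone_left hu.2

/-- The corner `(u₁, v₁ - π)` of the complementary rectangle is not in `L`: its future lightcone
would contain `L`. -/
lemma lower_corner_not_mem (h : IsGapRect L u₀ u₁ v₀ v₁) (hL : IsAchronal L)
    (hnonel : ¬ IsElementary L) : nullPt u₁ (v₁ - π) ∉ L := by
  intro hc
  refine hnonel (Or.inr ⟨nullPt u₁ (v₁ - π), fun q hq => ?_⟩)
  obtain ⟨u, hu, v, hv, rfl⟩ := h.exists_nullPt_eq hL hq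
  have := hL.mul_nonpos hc hq
  rcases hu.1.eq_or_lt with e | hlt
  · rw [← e]; exact mem_futureLightcone_right hv.1
  · rw [show v = v₁ - π from le_antisymm (by nlinarith) hv.1]
    exact mem_futureLightcone_left hu.1

lemma formB_nonpos (h : IsGapRect L u₀ u₁ v₀ v₁) (hL : IsAchronal L) {q : EinHat} (hq : q ∈ L)
    {u v : ℝ} (hu : u ∈ Icc u₀ u₁) (hv : v ∈ Icc v₀ v₁) :
    formB (nullVec (nullPt u v)) (nullVec q) ≤ 0 := by
  obtain ⟨u', hu', v', hv', rfl⟩ := h.exists_nullPt_eq hL hq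
  rw [formB_nullPt, ← neg_sub u' u, sin_neg]
  have h1 : 0 ≤ sin (u' - u) :=
    sin_nonneg_of_nonneg_of_le_pi (by linarith [hu.2, hu'.1]) (by linarith [hu.1, hu'.2])
  have h2 : 0 ≤ sin (v - v') :=
    sin_nonneg_of_nonneg_of_le_pi (by linarith [hv.1, hv'.2]) (by linarith [hv.2, hv'.1])
  nlinarith [mul_nonneg h1 h2]

/-- No point of `L` is lightlike related to both ends of the gap. -/
lemma formB_neg_left_or_right (h : IsGapRect L u₀ u₁ v₀ v₁) (hL : IsAchronal L)
    (hnonel : ¬ IsElementary L) (hu₀₁ : u₀ < u₁) (hv₀₁ : v₀ < v₁) {q : EinHat} (hq : q ∈ L) :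
    formB (nullVec (nullPt u₀ v₁)) (nullVec q) < 0 ∨
      formB (nullVec (nullPt u₁ v₀)) (nullVec q) < 0 := by
  obtain ⟨u, hu, v, hv, rfl⟩ := h.exists_nullPt_eq hL hq
  obtain ⟨hα, hβ⟩ := h.sub_lt_pi hL hnonel
  have aux : ∀ r s : ℝ, 0 < r → r < π → 0 < s → s < π → 2 * sin (-r) * sin s < 0 := by
    intro r s h1 h2 h3 h4
    rw [sin_neg]
    nlinarith [mul_pos (sin_pos_of_pos_of_lt_pi h1 h2) (sin_pos_of_pos_of_lt_pi h3 h4)]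
  rw [formB_nullPt, formB_nullPt, ← neg_sub u u₀, ← neg_sub u u₁]
  rcases hu.2.eq_or_lt with eu | hu2
  · right
    apply aux
    · linarith
    · linarith
    · rcases hv.2.eq_or_lt with ev | hv2
      · subst eu ev
        exact absurd hq (h.upper_corner_not_mem hL hnonel)
      · linarith
    · linarith [hv.1]
  rcases hv.1.eq_or_lt with ev | hv1
  · right
    apply aux
    · rcases hu.1.eq_or_lt with eu | hu1
      · subst eu ev
        exact absurd hq (h.lower_corner_not_mem hL hnonel)
      · linarith
    · linarith
    · linarith
    · linarith
  left
  apply aux <;> linarith [hu.1, hv.2]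

end IsGapRect

namespace IsGapRect

variable {L : Set EinHat} {u₀ u₁ v₀ v₁ : ℝ}

/-- Over a gap, `Λ⁺` runs along the two upper sides of the rectangle. -/
lemma exists_fPlus_eq_nullPt (h : IsGapRect L u₀ u₁ v₀ v₁) (hL : IsAchronal L) (hK : IsCompact L)
    {s : ℝ} (hs : s ∈ Ioo (u₀ - v₁) (u₁ - v₀)) :
    ∃ u ∈ Icc u₀ u₁, ∃ v ∈ Icc v₀ v₁, (u = u₁ ∨ v = v₁) ∧
      nullPt u v = ((s : Real.Angle), fPlus L (equator s)) := by
  obtain ⟨q, hq, e⟩ := exists_fPlus_eq hK ⟨_, h.left_mem⟩ (norm_equator s)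
  have h1 := fPlus_le hK (norm_equator s) h.left_mem
  have h2 := fPlus_le hK (norm_equator s) h.right_mem
  have d1 := sphDist_coe_le s (u₀ - v₁)
  have d2 := sphDist_coe_le s (u₁ - v₀)
  rw [abs_of_pos (by linarith [hs.1])] at d1
  rw [abs_of_neg (by linarith [hs.2])] at d2
  obtain ⟨u', hu', v', hv', rfl⟩ := h.exists_nullPt_eq hL hq
  simp only [nullPt] at h1 h2 e
  set f := fPlus L (equator s)
  have b1 : (f - s) / 2 ≤ v₁ := by linarith
  have b2 : (f + s) / 2 ≤ u₁ := by linarith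
  have h3 : (f + s) / 2 = u₁ ∨ (f - s) / 2 = v₁ := by
    rcases sphDist_coe_eq_or (s := s) (t := u' - v') (by linarith [hs.2, hu'.1, hv'.2])
      (by linarith [hs.1, hu'.2, hv'.1]) with h4 | h4
    · left; rw [h4] at e; linarith [hu'.1]
    · right; rw [h4] at e; linarith [hv'.1]
  obtain ⟨hu, hv⟩ := h.abs_le_of_isAchronal hL
  obtain ⟨hs1, hs2⟩ := hs
  refine ⟨(f + s) / 2, ?_, (f - s) / 2, ?_, h3, nullPt_half _ _⟩ <;>
  · clear e h1 h2 d1 d2 hu' hv' hq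
    clear_value f
    rcases h3 with h3 | h3 <;> constructor <;> linarith

/-- Over a gap, `Λ⁻` runs along the two lower sides of the rectangle. -/
lemma exists_fMinus_eq_nullPt (h : IsGapRect L u₀ u₁ v₀ v₁) (hL : IsAchronal L) (hK : IsCompact L)
    {s : ℝ} (hs : s ∈ Ioo (u₀ - v₁) (u₁ - v₀)) :
    ∃ u ∈ Icc u₀ u₁, ∃ v ∈ Icc v₀ v₁, (u = u₀ ∨ v = v₀) ∧
      nullPt u v = ((s : Real.Angle), fMinus L (equator s)) := by
  obtain ⟨q, hq, e⟩ := exists_fMinus_eq hK ⟨_, h.left_mem⟩ (norm_equator s)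
  have h1 := le_fMinus hK (norm_equator s) h.left_mem
  have h2 := le_fMinus hK (norm_equator s) h.right_mem
  have d1 := sphDist_coe_le s (u₀ - v₁)
  have d2 := sphDist_coe_le s (u₁ - v₀)
  rw [abs_of_pos (by linarith [hs.1])] at d1
  rw [abs_of_neg (by linarith [hs.2])] at d2
  obtain ⟨u', hu', v', hv', rfl⟩ := h.exists_nullPt_eq hL hq
  simp only [nullPt] at h1 h2 e
  set f := fMinus L (equator s)
  have b1 : u₀ ≤ (f + s) / 2 := by linarith
  have b2 : v₀ ≤ (f - s) / 2 := by linarith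
  have h3 : (f + s) / 2 = u₀ ∨ (f - s) / 2 = v₀ := by
    rcases sphDist_coe_eq_or (s := s) (t := u' - v') (by linarith [hs.2, hu'.1, hv'.2])
      (by linarith [hs.1, hu'.2, hv'.1]) with h4 | h4
    · right; rw [h4] at e; linarith [hv'.2]
    · left; rw [h4] at e; linarith [hu'.2]
  obtain ⟨hu, hv⟩ := h.abs_le_of_isAchronal hL
  obtain ⟨hs1, hs2⟩ := hs
  refine ⟨(f + s) / 2, ?_, (f - s) / 2, ?_, h3, nullPt_half _ _⟩ <;>
  · clear e h1 h2 d1 d2 hu' hv' hq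
    clear_value f
    rcases h3 with h3 | h3 <;> constructor <;> linarith

end IsGapRect

/-! ### Diamonds and closed ends -/

/-- The open arc of the circle which is the image of an open interval. -/
def arc (a b : ℝ) : Set Real.Angle := (fun s : ℝ => (s : Real.Angle)) '' Ioo a b

lemma diamond_eq_image {u₀ u₁ v₀ v₁ : ℝ} (hu : u₁ - u₀ < π) (hv : v₁ - v₀ < π) :
    diamond (nullPt u₀ v₁) (nullPt u₁ v₀) (arc (u₀ - v₁) (u₁ - v₀)) =
      (fun p : ℝ × ℝ => nullPt p.1 p.2) '' (Ioo u₀ u₁ ×ˢ Ioo v₀ v₁) := by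
  have hK : IsCompact {nullPt u₀ v₁, nullPt u₁ v₀} := (toFinite _).isCompact
  have hl : nullPt u₀ v₁ ∈ ({nullPt u₀ v₁, nullPt u₁ v₀} : Set EinHat) := mem_insert _ _
  have hr : nullPt u₁ v₀ ∈ ({nullPt u₀ v₁, nullPt u₁ v₀} : Set EinHat) :=
    mem_insert_of_mem _ rfl
  apply Subset.antisymm
  · rintro ⟨_, t⟩ ⟨⟨s, hs, rfl⟩, h1, h2⟩
    simp only at h1 h2
    have a1 := (le_fMinus hK (norm_equator s) hl).trans_lt h1
    have a2 := (le_fMinus hK (norm_equator s) hr).trans_lt h1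
    have b1 := h2.trans_le (fPlus_le hK (norm_equator s) hl)
    have b2 := h2.trans_le (fPlus_le hK (norm_equator s) hr)
    have d1 := sphDist_coe_le s (u₀ - v₁)
    have d2 := sphDist_coe_le s (u₁ - v₀)
    rw [abs_of_pos (by linarith [hs.1])] at d1
    rw [abs_of_neg (by linarith [hs.2])] at d2
    simp only [nullPt] at a1 a2 b1 b2
    refine ⟨((t + s) / 2, (t - s) / 2), ⟨⟨?_, ?_⟩, ⟨?_, ?_⟩⟩, nullPt_half s t⟩ <;>
    simp only <;> linarith
  · rintro _ ⟨⟨u, v⟩, ⟨⟨h1, h2⟩, h3, h4⟩, rfl⟩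
    simp only at h1 h2 h3 h4
    have key : ∀ p ∈ ({nullPt u₀ v₁, nullPt u₁ v₀} : Set EinHat),
        |p.2 - (u + v)| < sphDist (equator ((u - v : ℝ) : Real.Angle)) (equator p.1) := by
      rintro p (rfl | rfl)
      · rw [sphDist_comm]
        rcases sphDist_coe_eq_or (s := u₀ - v₁) (t := u - v) (by linarith) (by linarith)
          with e | e <;> simp only [nullPt] <;> rw [e, abs_lt] <;> constructor <;> linarith
      · rcases sphDist_coe_eq_or (s := u - v) (t := u₁ - v₀) (by linarith) (by linarith)
          with e | e <;> simp only [nullPt] <;> rw [e, abs_lt] <;> constructor <;> linarith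
    refine ⟨⟨u - v, ⟨by linarith, by linarith⟩, rfl⟩,
      fMinus_lt hK ⟨_, hl⟩ (norm_equator _) fun p hp => ?_,
      lt_fPlus hK ⟨_, hl⟩ (norm_equator _) fun p hp => ?_⟩
    · have := (abs_lt.1 (key p hp)).2
      simp only [nullPt] at this ⊢
      linarith
    · have := (abs_lt.1 (key p hp)).1
      simp only [nullPt] at this ⊢
      linarith

lemma closure_diamond_eq_image {u₀ u₁ v₀ v₁ : ℝ} (hu : u₁ - u₀ < π) (hv : v₁ - v₀ < π)
    (hu' : u₀ < u₁) (hv' : v₀ < v₁) :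
    closure (diamond (nullPt u₀ v₁) (nullPt u₁ v₀) (arc (u₀ - v₁) (u₁ - v₀))) =
      (fun p : ℝ × ℝ => nullPt p.1 p.2) '' (Icc u₀ u₁ ×ˢ Icc v₀ v₁) := by
  have hc : closure (Ioo u₀ u₁ ×ˢ Ioo v₀ v₁) = Icc u₀ u₁ ×ˢ Icc v₀ v₁ := by
    rw [closure_prod_eq, closure_Ioo hu'.ne, closure_Ioo hv'.ne]
  rw [diamond_eq_image hu hv, ← hc]
  refine (image_closure_of_isCompact ?_ continuous_nullPt.continuousOn).symm
  rw [hc]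
  exact isCompact_Icc.prod isCompact_Icc

/-- The nonnegative combinations of four vectors. -/
def coneHull (x y z w : R22) : Set R22 :=
  {v | ∃ a b c d : ℝ, 0 ≤ a ∧ 0 ≤ b ∧ 0 ≤ c ∧ 0 ≤ d ∧ v = a • x + b • y + c • z + d • w}

lemma convex_coneHull (x y z w : R22) : Convex ℝ (coneHull x y z w) := by
  rintro _ ⟨a, b, c, d, ha, hb, hc, hd, rfl⟩ _ ⟨a', b', c', d', ha', hb', hc', hd', rfl⟩ r s hr hs _
  exact ⟨r * a + s * a', r * b + s * b', r * c + s * c', r * d + s * d', by positivity,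
    by positivity, by positivity, by positivity, by module⟩

lemma nullVec_mem_coneOver {D : Set EinHat} {p : EinHat} (hp : p ∈ D) :
    nullVec p ∈ coneOver (toEin D) :=
  ⟨nullVec_ne_zero p, nullVec p, nullVec_ne_zero p, ⟨p, hp, rfl⟩, rfl⟩

lemma exists_eq_smul_nullVec {D : Set EinHat} {w : R22} (hw : w ∈ coneOver (toEin D)) :
    ∃ p ∈ D, ∃ c : ℝ, 0 < c ∧ w = c • nullVec p := by
  obtain ⟨hw0, _, hv, ⟨p, hp, rfl⟩, hr⟩ := hw
  rw [ray_eq_iff] at hr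
  obtain ⟨c, hc, e⟩ := hr.exists_pos_left hv hw0
  exact ⟨p, hp, c, hc, e.symm⟩

lemma rayOfNeZero_mem_rayConvexHull {D : Set EinHat} {x y z w : EinHat} (hx : x ∈ D) (hy : y ∈ D)
    (hz : z ∈ D) (hw : w ∈ D) {v : R22} (hv0 : v ≠ 0)
    (hv : v ∈ coneHull (nullVec x) (nullVec y) (nullVec z) (nullVec w)) :
    rayOfNeZero ℝ v hv0 ∈ rayConvexHull (toEin D) := by
  obtain ⟨a, b, c, d, ha, hb, hc, hd, e⟩ := hv
  have hS : 0 < a + b + c + d := by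
    refine lt_of_le_of_ne (by positivity) fun h => hv0 ?_
    have ha0 : a = 0 := by linarith
    have hb0 : b = 0 := by linarith
    have hc0 : c = 0 := by linarith
    have hd0 : d = 0 := by linarith
    simp [e, ha0, hb0, hc0, hd0]
  set S := a + b + c + d with hSdef
  have hne : S⁻¹ • v ≠ 0 := smul_ne_zero (inv_ne_zero hS.ne') hv0
  refine ⟨S⁻¹ • v, hne, ?_, rayOfNeZero_smul_eq (inv_pos.2 hS) rfl hne hv0⟩
  have hmem : ∀ i : Fin 4, ![nullVec x, nullVec y, nullVec z, nullVec w] i ∈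
      convexHull ℝ (coneOver (toEin D)) := by
    intro i
    apply subset_convexHull
    fin_cases i
    exacts [nullVec_mem_coneOver hx, nullVec_mem_coneOver hy, nullVec_mem_coneOver hz,
      nullVec_mem_coneOver hw]
  have h := (convex_convexHull ℝ (coneOver (toEin D))).sum_mem (t := Finset.univ)
    (w := ![S⁻¹ * a, S⁻¹ * b, S⁻¹ * c, S⁻¹ * d])
    (z := ![nullVec x, nullVec y, nullVec z, nullVec w]) ?_ ?_ (fun i _ => hmem i)
  · rw [e]
    simp only [Fin.sum_univ_four, Matrix.cons_val] at h
    simpa only [smul_add, smul_smul] using h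
  · intro i _
    fin_cases i <;> simp <;> positivity
  · simp only [Fin.sum_univ_four, Matrix.cons_val]
    rw [← mul_add, ← mul_add, ← mul_add, inv_mul_cancel₀ hS.ne']

/-- In terms of the coordinates `a`, `b`, `c`, `d` of a vector with respect to the corners of a
rectangle, `Q` is a positive multiple of `c d - a b`. -/
lemma Q_corner_combination (u₀ u₁ v₀ v₁ a b c d : ℝ) :
    Q (a • nullVec (nullPt u₀ v₁) + b • nullVec (nullPt u₁ v₀) + c • nullVec (nullPt u₁ v₁)
      + d • nullVec (nullPt u₀ v₀)) = 4 * (sin (u₁ - u₀) * sin (v₁ - v₀)) * (c * d - a * b) := by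
  simp only [nullVec_nullPt, Q, Pi.add_apply, Pi.smul_apply, Matrix.cons_val, smul_eq_mul, cos_add,
    sin_add, cos_sub, sin_sub]
  ring

namespace IsGapRect

variable {L : Set EinHat} {u₀ u₁ v₀ v₁ : ℝ}

lemma closedEnd_subset_invisible (h : IsGapRect L u₀ u₁ v₀ v₁) (hL : IsAchronal L)
    (hK : IsCompact L) (hnonel : ¬ IsElementary L) :
    closedEnd (nullPt u₀ v₁) (nullPt u₁ v₀) (arc (u₀ - v₁) (u₁ - v₀)) ⊆ invisible L := by
  obtain ⟨hα, hβ⟩ := h.sub_lt_pi hL hnonel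
  rintro _ ⟨hr, w, hw, hwc, rfl⟩
  rw [rayOfNeZero_mem_klein_iff] at hr
  -- a degenerate rectangle has an empty open diamond
  obtain ⟨hu, hv⟩ : u₀ < u₁ ∧ v₀ < v₁ := by
    obtain ⟨w', hw'⟩ := convexHull_nonempty_iff.1 ⟨w, hwc⟩
    obtain ⟨p, hp, -⟩ := exists_eq_smul_nullVec hw'
    obtain ⟨p', hp'⟩ := closure_nonempty_iff.1 ⟨p, hp⟩
    rw [diamond_eq_image hα hβ] at hp'
    obtain ⟨_, ⟨hu, hv⟩, -⟩ := hp'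
    exact ⟨hu.1.trans hu.2, hv.1.trans hv.2⟩
  have hsub : convexHull ℝ (coneOver (toEin (closure
      (diamond (nullPt u₀ v₁) (nullPt u₁ v₀) (arc (u₀ - v₁) (u₁ - v₀)))))) ⊆
      coneHull (nullVec (nullPt u₀ v₁)) (nullVec (nullPt u₁ v₀)) (nullVec (nullPt u₁ v₁))
        (nullVec (nullPt u₀ v₀)) := by
    refine convexHull_min (fun w' hw' => ?_) (convex_coneHull _ _ _ _)
    obtain ⟨p, hp, r, hr0, rfl⟩ := exists_eq_smul_nullVec hw'
    rw [closure_diamond_eq_image hα hβ hu hv] at hp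
    obtain ⟨⟨u, v⟩, ⟨hu', hv'⟩, rfl⟩ := hp
    obtain ⟨a, b, ha, hb, -, e⟩ := exists_combination_left v hα hu'
    obtain ⟨a₀, b₀, ha₀, hb₀, -, e₀⟩ := exists_combination_right u₀ hβ hv'
    obtain ⟨a₁, b₁, ha₁, hb₁, -, e₁⟩ := exists_combination_right u₁ hβ hv'
    refine ⟨r * a * b₀, r * b * a₁, r * b * b₁, r * a * a₀, by positivity, by positivity,
      by positivity, by positivity, ?_⟩
    simp only at e₀ e₁
    rw [e, e₀, e₁]
    module
  obtain ⟨a, b, c, d, ha, hb, hc, hd, rfl⟩ := hsub hwc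
  have hsin : 0 < sin (u₁ - u₀) * sin (v₁ - v₀) :=
    mul_pos (sin_pos_of_pos_of_lt_pi (by linarith) hα) (sin_pos_of_pos_of_lt_pi (by linarith) hβ)
  have hab : 0 < a * b := by
    rw [Q_corner_combination] at hr
    have : c * d - a * b < 0 := by
      by_contra! hc'
      have := mul_nonneg hsin.le hc'
      linarith
    linarith [mul_nonneg hc hd]
  have ha' : 0 < a := pos_of_mul_pos_left hab hb
  have hb' : 0 < b := pos_of_mul_pos_right hab ha
  refine rayOfNeZero_mem_invisible hL hK ⟨_, h.left_mem⟩ hw hr fun q hq => ?_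
  simp only [formB_add_left, formB_smul_left]
  have hX := h.formB_nonpos hL hq (left_mem_Icc.2 hu.le) (right_mem_Icc.2 hv.le)
  have hY := h.formB_nonpos hL hq (right_mem_Icc.2 hu.le) (left_mem_Icc.2 hv.le)
  have hZ := h.formB_nonpos hL hq (right_mem_Icc.2 hu.le) (right_mem_Icc.2 hv.le)
  have hW := h.formB_nonpos hL hq (left_mem_Icc.2 hu.le) (left_mem_Icc.2 hv.le)
  have hZ' := mul_nonpos_of_nonneg_of_nonpos hc hZ
  have hW' := mul_nonpos_of_nonneg_of_nonpos hd hW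
  rcases h.formB_neg_left_or_right hL hnonel hu hv hq with hs | hs
  · have := mul_neg_of_pos_of_neg ha' hs
    have := mul_nonpos_of_nonneg_of_nonpos hb hY
    linarith
  · have := mul_neg_of_pos_of_neg hb' hs
    have := mul_nonpos_of_nonneg_of_nonpos ha hX
    linarith

/-- A point of the invisible domain that is hidden both by a point of `Λ⁺` and by a point of `Λ⁻`
over the same gap lies in the corresponding closed end: all its coordinates with respect to the
corners of the rectangle are nonnegative. -/
lemma rayOfNeZero_mem_closedEnd (h : IsGapRect L u₀ u₁ v₀ v₁) (hL : IsAchronal L)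
    (hK : IsCompact L) (hnonel : ¬ IsElementary L) {w : R22} (hw : w ≠ 0) (hQ : Q w < 0)
    (hneg : ∀ q ∈ L, formB w (nullVec q) < 0) {s t : ℝ}
    (hs : s ∈ Ioo (u₀ - v₁) (u₁ - v₀)) (ht : t ∈ Ioo (u₀ - v₁) (u₁ - v₀))
    (hplus : 0 ≤ formB w (nullVec ((s : Real.Angle), fPlus L (equator s))))
    (hminus : 0 ≤ formB w (nullVec ((t : Real.Angle), fMinus L (equator t)))) :
    rayOfNeZero ℝ w hw ∈
      closedEnd (nullPt u₀ v₁) (nullPt u₁ v₀) (arc (u₀ - v₁) (u₁ - v₀)) := by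
  obtain ⟨hα, hβ⟩ := h.sub_lt_pi hL hnonel
  obtain ⟨hu, hv⟩ := h.abs_le_of_isAchronal hL
  have hX := hneg _ h.left_mem
  have hY := hneg _ h.right_mem
  have aux : ∀ c d A B : ℝ, 0 ≤ c → 0 ≤ d → 0 < c + d → A < 0 → 0 ≤ c * A + d * B → 0 ≤ B := by
    intro c d A B hc hd hcd hA hAB
    by_contra! hB
    rcases hc.eq_or_lt with rfl | hc
    · have := mul_neg_of_pos_of_neg (show 0 < d by linarith) hB
      linarith
    · have := mul_neg_of_pos_of_neg hc hA
      have := mul_nonpos_of_nonneg_of_nonpos hd hB.le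
      linarith
  have hZ : 0 ≤ formB w (nullVec (nullPt u₁ v₁)) := by
    obtain ⟨u, hu', v, hv', huv, e⟩ := h.exists_fPlus_eq_nullPt hL hK hs
    rw [← e] at hplus
    rcases huv with rfl | rfl
    · obtain ⟨c, d, hc, hd, hcd, e'⟩ := exists_combination_right u hβ hv'
      rw [e', formB_add_right, formB_smul_right, formB_smul_right] at hplus
      exact aux c d _ _ hc hd hcd hY hplus
    · obtain ⟨c, d, hc, hd, hcd, e'⟩ := exists_combination_left v hα hu'
      rw [e', formB_add_right, formB_smul_right, formB_smul_right] at hplus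
      exact aux c d _ _ hc hd hcd hX hplus
  have hW : 0 ≤ formB w (nullVec (nullPt u₀ v₀)) := by
    obtain ⟨u, hu', v, hv', huv, e⟩ := h.exists_fMinus_eq_nullPt hL hK ht
    rw [← e] at hminus
    rcases huv with rfl | rfl
    · obtain ⟨c, d, hc, hd, hcd, e'⟩ := exists_combination_right u hβ hv'
      rw [e', formB_add_right, formB_smul_right, formB_smul_right, add_comm] at hminus
      exact aux d c _ _ hd hc (by linarith) hX hminus
    · obtain ⟨c, d, hc, hd, hcd, e'⟩ := exists_combination_left v hα hu'
      rw [e', formB_add_right, formB_smul_right, formB_smul_right, add_comm] at hminus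
      exact aux d c _ _ hd hc (by linarith) hY hminus
  -- in a degenerate rectangle the upper corner is one of the two points of `L`
  have hu' : u₀ < u₁ := by
    refine hu.lt_of_ne fun e => ?_
    rw [← e] at hZ
    linarith
  have hv' : v₀ < v₁ := by
    refine hv.lt_of_ne fun e => ?_
    rw [← e] at hZ
    linarith
  refine ⟨(rayOfNeZero_mem_klein_iff hw).2 hQ, ?_⟩
  have hcorner : ∀ u ∈ Icc u₀ u₁, ∀ v ∈ Icc v₀ v₁, nullPt u v ∈
      closure (diamond (nullPt u₀ v₁) (nullPt u₁ v₀) (arc (u₀ - v₁) (u₁ - v₀))) := by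
    intro u hu v hv
    rw [closure_diamond_eq_image hα hβ hu' hv']
    exact ⟨(u, v), ⟨hu, hv⟩, rfl⟩
  refine rayOfNeZero_mem_rayConvexHull
    (hcorner u₀ (left_mem_Icc.2 hu) v₁ (right_mem_Icc.2 hv))
    (hcorner u₁ (right_mem_Icc.2 hu) v₀ (left_mem_Icc.2 hv))
    (hcorner u₁ (right_mem_Icc.2 hu) v₁ (right_mem_Icc.2 hv))
    (hcorner u₀ (left_mem_Icc.2 hu) v₀ (left_mem_Icc.2 hv)) hw ?_
  have hM : 0 < 2 * sin (u₁ - u₀) * sin (v₁ - v₀) := by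
    have := sin_pos_of_pos_of_lt_pi (sub_pos.2 hu') hα
    have := sin_pos_of_pos_of_lt_pi (sub_pos.2 hv') hβ
    positivity
  set M := 2 * sin (u₁ - u₀) * sin (v₁ - v₀) with hMdef
  have hdec := smul_eq_corner_combination u₀ u₁ v₀ v₁ w
  rw [← hMdef] at hdec
  have hMi := inv_pos.2 hM
  refine ⟨M⁻¹ * -formB w (nullVec (nullPt u₁ v₀)), M⁻¹ * -formB w (nullVec (nullPt u₀ v₁)),
    M⁻¹ * formB w (nullVec (nullPt u₀ v₀)), M⁻¹ * formB w (nullVec (nullPt u₁ v₁)),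
    mul_nonneg hMi.le (by linarith), mul_nonneg hMi.le (by linarith), mul_nonneg hMi.le hW,
    mul_nonneg hMi.le hZ, ?_⟩
  rw [mul_smul, mul_smul, mul_smul, mul_smul, ← smul_add, ← smul_add, ← smul_add, ← hdec,
    inv_smul_smul₀ hM.ne']

end IsGapRect

/-! ### Complementary components of closed subsets of the circle -/

lemma isOpen_arc (a b : ℝ) : IsOpen (arc a b) :=
  QuotientAddGroup.isOpenMap_coe _ isOpen_Ioo

lemma closure_arc {a b : ℝ} (h : a < b) :
    closure (arc a b) = (fun s : ℝ => (s : Real.Angle)) '' Icc a b := by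
  rw [← closure_Ioo h.ne]
  refine (image_closure_of_isCompact ?_ Real.Angle.continuous_coe.continuousOn).symm
  rw [closure_Ioo h.ne]
  exact isCompact_Icc

lemma frontier_arc {a b : ℝ} (h : a < b) (ha : (a : Real.Angle) ∉ arc a b)
    (hb : (b : Real.Angle) ∉ arc a b) :
    frontier (arc a b) = {(a : Real.Angle), (b : Real.Angle)} := by
  rw [(isOpen_arc a b).frontier_eq, closure_arc h, ← Ioo_union_both h.le, image_union,
    image_pair, union_sdiff_distrib]
  change arc a b \ arc a b ∪ _ = _
  rw [Set.sdiff_self, empty_union]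
  refine sdiff_eq_left.2 (disjoint_left.2 ?_)
  rintro _ (rfl | rfl)
  exacts [ha, hb]

/-- The component of a point in the complement of a nonempty closed subset of the circle is an open
arc with ends in that subset; the two ends coincide if the subset is a single point. -/
lemma exists_connectedComponentIn_eq_arc {K : Set Real.Angle} (hK : IsClosed K) (hne : K.Nonempty)
    {φ : Real.Angle} (hφ : φ ∉ K) :
    ∃ a b : ℝ, a < b ∧ (a : Real.Angle) ∈ K ∧ (b : Real.Angle) ∈ K ∧
      (∀ s ∈ Ioo a b, (s : Real.Angle) ∉ K) ∧ connectedComponentIn Kᶜ φ = arc a b := by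
  obtain ⟨k, hk⟩ := hne
  induction k using Real.Angle.induction_on with | _ k
  induction φ using Real.Angle.induction_on with | _ r
  have hcl : IsClosed {s : ℝ | (s : Real.Angle) ∈ K} := hK.preimage Real.Angle.continuous_coe
  set A := {s : ℝ | (s : Real.Angle) ∈ K} ∩ Iic r
  set B := {s : ℝ | (s : Real.Angle) ∈ K} ∩ Ici r
  have hA : sSup A ∈ A := by
    refine (hcl.inter isClosed_Iic).csSup_mem ⟨toIocMod two_pi_pos (r - 2 * π) k, ?_, ?_⟩
      ⟨r, fun s hs => hs.2⟩
    · simpa [coe_toIocMod] using hk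
    · have := (toIocMod_mem_Ioc two_pi_pos (r - 2 * π) k).2
      simpa using this
  have hB : sInf B ∈ B := by
    refine (hcl.inter isClosed_Ici).csInf_mem ⟨toIocMod two_pi_pos r k, ?_, ?_⟩
      ⟨r, fun s hs => hs.2⟩
    · simpa [coe_toIocMod] using hk
    · exact (toIocMod_mem_Ioc two_pi_pos r k).1.le
  have har : sSup A < r := lt_of_le_of_ne hA.2 fun e => hφ (e ▸ hA.1)
  have hbr : r < sInf B := lt_of_le_of_ne hB.2 fun e => hφ (e ▸ hB.1)
  have hgap : ∀ s ∈ Ioo (sSup A) (sInf B), (s : Real.Angle) ∉ K := by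
    intro s hs hsK
    rcases le_total s r with h | h
    · exact hs.1.not_ge (le_csSup ⟨r, fun s hs => hs.2⟩ ⟨hsK, h⟩)
    · exact hs.2.not_ge (csInf_le ⟨r, fun s hs => hs.2⟩ ⟨hsK, h⟩)
  have hmem : (r : Real.Angle) ∈ arc (sSup A) (sInf B) := ⟨r, ⟨har, hbr⟩, rfl⟩
  refine ⟨sSup A, sInf B, har.trans hbr, hA.1, hB.1, hgap, Subset.antisymm ?_ ?_⟩
  · refine isPreconnected_connectedComponentIn.subset_of_closure_inter_subset (isOpen_arc _ _)
      ⟨_, mem_connectedComponentIn hφ, hmem⟩ ?_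
    rintro ψ ⟨h1, h2⟩
    have h3 := connectedComponentIn_subset _ _ h2
    rw [closure_arc (har.trans hbr)] at h1
    obtain ⟨s, hs, rfl⟩ := h1
    refine ⟨s, ⟨lt_of_le_of_ne hs.1 fun e => h3 ?_, lt_of_le_of_ne hs.2 fun e => h3 ?_⟩, rfl⟩
    · have := hA.1
      rw [e] at this
      exact this
    · have := hB.1
      rw [← e] at this
      exact this
  · refine IsPreconnected.subset_connectedComponentIn ?_ hmem ?_
    · exact isPreconnected_Ioo.image _ Real.Angle.continuous_coe.continuousOn
    · rintro _ ⟨s, hs, rfl⟩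
      exact hgap s hs

lemma mem_connectedComponentIn_of_not_between {K : Set Real.Angle} {φ ψ : Real.Angle}
    (h : ∀ χ ∈ K, sphDist (equator φ) (equator ψ) <
      sphDist (equator φ) (equator χ) + sphDist (equator ψ) (equator χ)) :
    φ ∉ K ∧ ψ ∈ connectedComponentIn Kᶜ φ := by
  set θ := (ψ - φ).toReal with hθ
  have hψ : φ + ((θ : ℝ) : Real.Angle) = ψ := by
    rw [hθ, Real.Angle.coe_toReal]; abel
  have hd : sphDist (equator φ) (equator ψ) = |θ| := by
    rw [sphDist_comm, sphDist_equator_equator]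
  set γ : ℝ → Real.Angle := fun s => φ + ((s * θ : ℝ) : Real.Angle) with hγ
  have hγ0 : γ 0 = φ := by simp [hγ]
  have hγ1 : γ 1 = ψ := by simp [hγ, hψ]
  have hγc : Continuous γ :=
    continuous_const.add (Real.Angle.continuous_coe.comp (continuous_id.mul continuous_const))
  have hsub : γ '' Icc 0 1 ⊆ Kᶜ := by
    rintro _ ⟨s, hs, rfl⟩ hsK
    have h1 := h _ hsK
    have h2 := sphDist_add_coe_le φ (0 * θ) (s * θ)
    have h3 := sphDist_add_coe_le φ (1 * θ) (s * θ)
    rw [← sub_mul, abs_mul] at h2 h3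
    rw [abs_of_nonpos (by linarith [hs.1])] at h2
    rw [abs_of_nonneg (by linarith [hs.2])] at h3
    change sphDist (equator (γ 0)) (equator (γ s)) ≤ _ at h2
    change sphDist (equator (γ 1)) (equator (γ s)) ≤ _ at h3
    rw [hγ0] at h2
    rw [hγ1] at h3
    rw [hd] at h1
    linarith
  have h0 : φ ∈ γ '' Icc 0 1 := ⟨0, by simp, hγ0⟩
  exact ⟨hsub h0, (isPreconnected_Icc.image _ hγc.continuousOn).subset_connectedComponentIn h0 hsub
    ⟨1, by simp, hγ1⟩⟩

/-! ### Gap pairs -/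

section GapPairs

variable {L : Set EinHat}

lemma exists_isGapRect (hcl : IsCompact L) (hne : L.Nonempty) {φ : Real.Angle}
    (hφ : φ ∉ Prod.fst '' L) :
    ∃ u₀ u₁ v₀ v₁ : ℝ, IsGapRect L u₀ u₁ v₀ v₁ ∧
      connectedComponentIn (Prod.fst '' L)ᶜ φ = arc (u₀ - v₁) (u₁ - v₀) := by
  have hK : IsClosed (Prod.fst '' L) := (hcl.image continuous_fst).isClosed
  obtain ⟨a, b, hab, ⟨⟨a', t⟩, ha, rfl : a' = a⟩, ⟨⟨b', t'⟩, hb, rfl : b' = b⟩, hgap, hI⟩ :=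
    exists_connectedComponentIn_eq_arc hK (hne.image _) hφ
  have e1 : (t + a) / 2 - (t - a) / 2 = a := by ring
  have e2 : (t' + b) / 2 - (t' - b) / 2 = b := by ring
  refine ⟨(t + a) / 2, (t' + b) / 2, (t' - b) / 2, (t - a) / 2, ⟨?_, ?_, ?_, ?_⟩, ?_⟩
  · rwa [e1, e2]
  · rwa [nullPt_half]
  · rwa [nullPt_half]
  · rwa [e1, e2]
  · rwa [e1, e2]

lemma IsGapRect.frontier_arc_eq {u₀ u₁ v₀ v₁ : ℝ} (h : IsGapRect L u₀ u₁ v₀ v₁) :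
    frontier (arc (u₀ - v₁) (u₁ - v₀)) = {(nullPt u₀ v₁).1, (nullPt u₁ v₀).1} := by
  refine frontier_arc h.lt ?_ ?_
  · rintro ⟨s, hs, e⟩
    exact h.not_mem s hs ⟨_, h.left_mem, e.symm⟩
  · rintro ⟨s, hs, e⟩
    exact h.not_mem s hs ⟨_, h.right_mem, e.symm⟩

lemma IsAchronal.injOn_fst (hL : IsAchronal L) : InjOn Prod.fst L := by
  intro p hp q hq e
  have h := hL.abs_sub_le hp hq
  rw [e, sphDist_equator_equator, sub_self, Real.Angle.toReal_zero, abs_zero] at h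
  exact Prod.ext e (sub_eq_zero.1 (abs_nonpos_iff.1 h))

lemma closedEnd_congr {x y x' y' : EinHat} (h : ({x, y} : Set EinHat) = {x', y'})
    (I : Set Real.Angle) : closedEnd x y I = closedEnd x' y' I := by
  unfold closedEnd diamond
  rw [h]

lemma IsGapPair.closedEnd_subset_invisible {x y : EinHat} {I : Set Real.Angle}
    (h : IsGapPair L x y I) (hL : IsAchronal L) (hK : IsCompact L) (hnonel : ¬ IsElementary L) :
    closedEnd x y I ⊆ invisible L := by
  obtain ⟨hx, hy, ⟨φ, hφ, hI⟩, hfr⟩ := h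
  obtain ⟨u₀, u₁, v₀, v₁, hrect, harc⟩ := exists_isGapRect hK ⟨x, hx⟩ hφ
  obtain rfl := hI.trans harc
  have hpair : ({x, y} : Set EinHat) = {nullPt u₀ v₁, nullPt u₁ v₀} := by
    rw [← hL.injOn_fst.image_eq_image_iff (pair_subset hx hy)
      (pair_subset hrect.left_mem hrect.right_mem), image_pair, image_pair, ← hfr,
      hrect.frontier_arc_eq]
  rw [closedEnd_congr hpair]
  exact hrect.closedEnd_subset_invisible hL hK hnonel

/-- A point of the invisible domain that is neither in `E(Λ⁺)` nor in `E(Λ⁻)` is in a closed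
end. -/
lemma exists_isGapPair_mem_closedEnd (hL : IsAchronal L) (hK : IsCompact L)
    (hnonel : ¬ IsElementary L) {p : E3 × ℝ} (hp : p ∈ invisibleHat L)
    (hp₁ : p ∉ invisibleHat (upperCompletion L)) (hp₂ : p ∉ invisibleHat (lowerCompletion L))
    (hw : kleinVec p ≠ 0) :
    ∃ x y I, IsGapPair L x y I ∧ rayOfNeZero ℝ (kleinVec p) hw ∈ closedEnd x y I := by
  have hne := nonempty_of_not_isElementary hnonel
  obtain ⟨q₀, hq₀⟩ := hne
  obtain ⟨x, t⟩ := p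
  obtain ⟨φ, hφ⟩ := exists_add_le_fPlus hK ⟨q₀, hq₀⟩ hp hp₁
  obtain ⟨ψ, hψ⟩ := exists_fMinus_add_le hK ⟨q₀, hq₀⟩ hp hp₂
  obtain ⟨hx, hm, hM⟩ := id hp
  simp only at hφ hψ hx hm hM
  obtain ⟨hφK, hψI⟩ := mem_connectedComponentIn_of_not_between (K := Prod.fst '' L) (φ := φ)
    (ψ := ψ) (by
      rintro _ ⟨q, hq, rfl⟩
      exact not_between_of_hidden hK hnonel hx hφ hψ hq)
  have hφI := mem_connectedComponentIn (F := (Prod.fst '' L)ᶜ) hφK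
  obtain ⟨u₀, u₁, v₀, v₁, hrect, harc⟩ := exists_isGapRect hK ⟨q₀, hq₀⟩ hφK
  rw [harc] at hψI hφI
  obtain ⟨s', hs', rfl⟩ := hφI
  obtain ⟨t', ht', rfl⟩ := hψI
  simp only at hφ hψ
  refine ⟨nullPt u₀ v₁, nullPt u₁ v₀, arc (u₀ - v₁) (u₁ - v₀),
    ⟨hrect.left_mem, hrect.right_mem, ⟨_, hφK, harc.symm⟩, hrect.frontier_arc_eq⟩,
    hrect.rayOfNeZero_mem_closedEnd hL hK hnonel hw (Q_kleinVec_neg hx)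
      (fun q hq => formB_neg_of_mem_invisibleHat hK hp hq) hs' ht' ?_ ?_⟩
  -- The bound `2π` on the perimeter of spherical triangles excludes a return of the sign of the
  -- form on the far side of the lightcone.
  · rw [formB_kleinVec_nullVec hx.1, sub_nonneg, ← cos_neg]
    have h1 := fPlus_le hK (norm_equator (s' : Real.Angle)) hq₀
    have h2 := le_fMinus hK hx.1 hq₀
    have h3 := sphDist_perimeter x (equator s') (equator q₀.1)
    have h4 := sphDist_nonneg x (equator s')
    exact cos_le_cos_of_le_of_le_two_pi_sub h4 (by simp only; linarith)
      (by simp only; linarith)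
  · rw [formB_kleinVec_nullVec hx.1, sub_nonneg]
    have h1 := le_fMinus hK (norm_equator (t' : Real.Angle)) hq₀
    have h2 := fPlus_le hK hx.1 hq₀
    have h3 := sphDist_perimeter x (equator t') (equator q₀.1)
    have h4 := sphDist_nonneg x (equator t')
    exact cos_le_cos_of_le_of_le_two_pi_sub h4 (by simp only; linarith)
      (by simp only; linarith)

end GapPairs

lemma toKlein_mono {S T : Set (E3 × ℝ)} (h : S ⊆ T) : toKlein S ⊆ toKlein T := by
  rintro _ ⟨w, hw, hwS, rfl⟩
  exact ⟨w, hw, image_mono h hwS, rfl⟩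

end AdSInvisible

open AdSInvisible
theorem mainTheorem7 (L : Set EinHat) (hclosed : IsClosed L) (hachronal : IsAchronal L)
    (hgeneric : IsGeneric L) (hnonelementary : ¬ IsElementary L) :
    invisible L =
      invisible (upperCompletion L) ∪ invisible (lowerCompletion L) ∪
        ⋃ (x : EinHat) (y : EinHat) (I : Set Real.Angle) (_ : IsGapPair L x y I),
          closedEnd x y I := by
  have hK := hachronal.isCompact hclosed
  have hne := nonempty_of_not_isElementary hnonelementary
  apply Set.Subset.antisymm
  · rintro _ ⟨_, hw, ⟨p, hp, rfl⟩, rfl⟩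
    by_cases h₁ : p ∈ invisibleHat (upperCompletion L)
    · exact Or.inl (Or.inl ⟨_, hw, ⟨p, h₁, rfl⟩, rfl⟩)
    by_cases h₂ : p ∈ invisibleHat (lowerCompletion L)
    · exact Or.inl (Or.inr ⟨_, hw, ⟨p, h₂, rfl⟩, rfl⟩)
    obtain ⟨x, y, I, hI, hmem⟩ :=
      exists_isGapPair_mem_closedEnd hachronal hK hnonelementary hp h₁ h₂ hw
    simp only [Set.mem_union, Set.mem_iUnion]
    exact Or.inr ⟨x, y, I, hI, hmem⟩
  · refine Set.union_subset (Set.union_subset (toKlein_mono ?_) (toKlein_mono ?_)) ?_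
    · exact invisibleHat_anti (hachronal.subset_upperCompletion hK) hne
        (isCompact_upperCompletion hK hne)
    · exact invisibleHat_anti (hachronal.subset_lowerCompletion hK) hne
        (isCompact_lowerCompletion hK hne)
    · simp only [Set.iUnion_subset_iff]
      exact fun x y I h => h.closedEnd_subset_invisible hachronal hK hnonelementary
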